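/- **Definitions.** An entourage on a set $X$ is a reflexive symmetric relation $\varepsilon\subseteq X\times X$; put $B(x,\varepsilon)=\{y\in X:(x,y)\in\varepsilon\}$ and $B(A,\varepsilon)=\bigcup_{a\in A}B(a,\varepsilon)$. A *ballean* is a set $X$ with a family $\mathcal E_X$ of entourages on $X$ (its radii) such that $\bigcup\mathcal E_X=X\times X$ and for all $\varepsilon,\delta\in\mathcal E_X$ the composition $\varepsilon\circ\delta=\{(x,z):\exists y\;(x,y)\in\varepsilon,\ (y,z)\in\delta\}$ is contained in some $\eta\in\mathcal E_X$. A subset $A\subseteq X$ is regarded as a ballean (a *subspace* of $X$) with the radii $\varepsilon\cap A^2$, $\varepsilon\in\mathcal E_X$. Let ${\downarrow}\mathcal E_X$ be the set of all entourages contained in some member of $\mathcal E_X$. A *base* of ${\downarrow}\mathcal E_X$ is a subfamily $\mathcal B\subseteq{\downarrow}\mathcal E_X$ such that each element of ${\downarrow}\mathcal E_X$ is contained in an element of $\mathcal B$; $\mathrm{cof}(X)$ is the smallest cardinality of a base. The ballean $X$ is *cellular* if ${\downarrow}\mathcal E_X$ has a base consisting of equivalence relations, and *ordinal* if ${\downarrow}\mathcal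 E_X$ has a base $\{B_\alpha\}_{\alpha<\kappa}\subseteq\mathcal E_X$, indexed by an ordinal $\kappa$, with $B_\alpha\subseteq B_\beta$ for all $\alpha<\beta<\kappa$. For $A\subseteq X$ let $\mathrm{cov}_\varepsilon(A)=\min\{|C|:C\subseteq X,\ A\subseteq B(C,\varepsilon)\}$. Let $\mathrm{cov}^\sharp(X)$ be the smallest cardinal $\kappa$ for which there is $\varepsilon\in\mathcal E_X$ such that $\sup_{x\in X}\mathrm{cov}_\varepsilon(B(x,\delta))<\kappa$ for every $\delta\in\mathcal E_X$. Let $\mathrm{cov}^\flat(X)$ be the largest cardinal $\kappa$ such that for every cardinal $\lambda<\kappa$ and every $\varepsilon\in\mathcal E_X$ there is $\delta\in\mathcal E_X$ with $\min_{x\in X}\mathrm{cov}_\varepsilon(B(x,\delta))\ge\lambda$. (Convention for $X=\emptyset$: the minimum over $x\in X$ is read as $0$, and $\mathrm{cov}^\sharp(X)=\mathrm{cov}^\flat(X)=0$ if $\mathcal E_X=\emptyset$.) A multi-map $\Phi\subseteq X\times Y$ between balleans is *coarse* if for every $\varepsilon\in\mathcal E_X$ there is $\delta\in\mathcal E_Y$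 containing $\Phi(x)\times\Phi(x')$ for all $(x,x')\in\varepsilon$, where $\Phi(x)=\{y:(x,y)\in\Phi\}$. Balleans $X,Y$ are *coarsely equivalent* if there is a multi-map $\Phi\subseteq X\times Y$ whose projections to $X$ and to $Y$ are surjective and such that both $\Phi$ and $\Phi^{-1}$ are coarse. (For nonempty balleans this is equivalent to $X$ and $Y$ having subspaces $L_X\subseteq X$, $L_Y\subseteq Y$ with $X=B(L_X,\varepsilon)$ and $Y=B(L_Y,\delta)$ for some radii $\varepsilon\in\mathcal E_X$, $\delta\in\mathcal E_Y$, and a bijection $L_X\to L_Y$ which is coarse together with its inverse.) **Theorem.** Let $X,Y$ be cellular ordinal balleans with $\mathrm{cof}(X)=\mathrm{cof}(Y)$. 1. If $\mathrm{cov}^\sharp(X)\le\mathrm{cov}^\flat(Y)$, then $X$ is coarsely equivalent to a subspace of $Y$. 2. If $\mathrm{cov}^\flat(X)=\mathrm{cov}^\sharp(X)=\mathrm{cov}^\sharp(Y)=\mathrm{cov}^\flat(Y)$, then $X$ and $Y$ are coarsely equivalent. -/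

import Mathlib

universe u

/-- An entourage on `X`: a reflexive symmetric relation, as a subset of `X × X`. -/
structure IsEntourage {X : Type u} (ε : Set (X × X)) : Prop where
  refl : ∀ x, (x, x) ∈ ε
  symm : ∀ x y, (x, y) ∈ ε → (y, x) ∈ ε

/-- A cellular entourage: an entourage which is transitive, that is, an equivalence relation. -/
structure IsCellularEntourage {X : Type u} (ε : Set (X × X)) : Prop extends IsEntourage ε where
  trans : ∀ x y z, (x, y) ∈ ε → (y, z) ∈ ε → (x, z) ∈ ε

/-- The ball `B(x, ε)`. -/
def entBall {X : Type u} (x : X) (ε : Set (X × X)) : Set X := {y | (x, y) ∈ ε}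

/-- The neighborhood `B(A, ε)`, the union of the balls `B(a, ε)` with `a ∈ A`. -/
def entNhd {X : Type u} (A : Set X) (ε : Set (X × X)) : Set X := ⋃ a ∈ A, entBall a ε

/-- The composition `ε ∘ δ = {(x, z) | ∃ y, (x, y) ∈ ε, (y, z) ∈ δ}`. -/
def entComp {X : Type u} (ε δ : Set (X × X)) : Set (X × X) :=
  {p | ∃ y, (p.1, y) ∈ ε ∧ (y, p.2) ∈ δ}

/-- `cov_ε(A)`: the smallest cardinality of a set `C ⊆ X` with `A ⊆ B(C, ε)`. -/
noncomputable def entCov {X : Type u} (ε : Set (X × X)) (A : Set X) : Cardinal.{u} :=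
  sInf {κ | ∃ C : Set X, Cardinal.mk C = κ ∧ A ⊆ entNhd C ε}

/-- A ballean structure on the set `X`; `radii` is the set of radii. -/
structure Ballean (X : Type u) where
  radii : Set (Set (X × X))
  isEntourage : ∀ ε ∈ radii, IsEntourage ε
  sUnion_radii : ⋃₀ radii = Set.univ
  comp_le : ∀ ε ∈ radii, ∀ δ ∈ radii, ∃ η ∈ radii, entComp ε δ ⊆ η

namespace Ballean

/-- The coarse structure `↓E` generated by the set of radii `E`: all entourages that are contained
in some radius. -/
def coarseStructure {X : Type u} (E : Ballean X) : Set (Set (X × X)) :=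
  {δ | IsEntourage δ ∧ ∃ ε ∈ E.radii, δ ⊆ ε}

/-- `𝓑` is a base of the coarse structure `↓E`: a family of elements of `↓E` such that
every element of `↓E` is contained in an element of the family. -/
def IsBase {X : Type u} (E : Ballean X) (𝓑 : Set (Set (X × X))) : Prop :=
  𝓑 ⊆ E.coarseStructure ∧ ∀ ε ∈ E.coarseStructure, ∃ δ ∈ 𝓑, ε ⊆ δ

/-- The cofinality: the smallest cardinality of a base of the coarse structure. -/
noncomputable def cof {X : Type u} (E : Ballean X) : Cardinal.{u} :=
  sInf {κ | ∃ 𝓑 : Set (Set (X × X)), E.IsBase 𝓑 ∧ Cardinal.mk 𝓑 = κ}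

/-- A ballean is ordinal if its coarse structure has a well-ordered base consisting of radii,
that is, a base `{b α : α < κ}` indexed by the ordinals below some ordinal `κ`,
with `b α ⊆ b β` for all `α < β < κ`. -/
def IsOrdinal {X : Type u} (E : Ballean X) : Prop :=
  ∃ (κ : Ordinal.{u}) (b : Ordinal.{u} → Set (X × X)),
    (∀ α < κ, b α ∈ E.radii) ∧ (∀ α β, α < β → β < κ → b α ⊆ b β) ∧
      E.IsBase (b '' Set.Iio κ)

/-- A ballean is cellular if its coarse structure has a base of equivalence relations. -/
def IsCellular {X : Type u} (E : Ballean X) : Prop :=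
  ∃ 𝓑 : Set (Set (X × X)), E.IsBase 𝓑 ∧ ∀ ε ∈ 𝓑, IsCellularEntourage ε

/-- `cov^♯`: the smallest cardinal `κ` for which there is a radius `ε` such that for every
radius `δ` we have `sup_x cov_ε(B(x, δ)) < κ`. -/
noncomputable def covSharp {X : Type u} (E : Ballean X) : Cardinal.{u} :=
  sInf {κ | ∃ ε ∈ E.radii, ∀ δ ∈ E.radii, (⨆ x : X, entCov ε (entBall x δ)) < κ}

/-- `cov^♭`: the largest cardinal `κ` such that for every cardinal `μ < κ` and every radius `ε`
there is a radius `δ` with `μ ≤ min_x cov_ε(B(x, δ))`. (For nonempty `X` the largest such cardinal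
exists; on the empty set the minimum over `x` is read as `0`.) -/
noncomputable def covFlat {X : Type u} (E : Ballean X) : Cardinal.{u} :=
  sSup {κ | ∀ μ < κ, ∀ ε ∈ E.radii, ∃ δ ∈ E.radii, μ ≤ ⨅ x : X, entCov ε (entBall x δ)}

/-- The subballean on `A ⊆ X`, with the radii `ε ∩ A²`. -/
def sub {X : Type u} (E : Ballean X) (A : Set X) : Ballean A where
  radii := (fun ε : Set (X × X) => {p : A × A | ((p.1 : X), (p.2 : X)) ∈ ε}) '' E.radii
  isEntourage := by
    rintro _ ⟨ε, hε, rfl⟩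
    exact ⟨fun x => (E.isEntourage ε hε).refl x, fun x y h => (E.isEntourage ε hε).symm x y h⟩
  sUnion_radii := by
    refine Set.eq_univ_of_forall fun p => ?_
    have h : ((p.1 : X), (p.2 : X)) ∈ ⋃₀ E.radii := by rw [E.sUnion_radii]; trivial
    obtain ⟨ε, hε, h⟩ := h
    exact ⟨_, ⟨ε, hε, rfl⟩, h⟩
  comp_le := by
    rintro _ ⟨ε, hε, rfl⟩ _ ⟨δ, hδ, rfl⟩
    obtain ⟨η, hη, h⟩ := E.comp_le ε hε δ hδ
    exact ⟨_, ⟨η, hη, rfl⟩, fun p ⟨y, h1, h2⟩ => h ⟨y, h1, h2⟩⟩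

/-- A multi-map `Φ ⊆ X × Y` is coarse if for every radius `ε` of `X` some radius `δ` of `Y` contains
the oscillation, the union of the sets `Φ(x) × Φ(x')` over `(x, x') ∈ ε`. -/
def IsCoarse {X Y : Type u} (E : Ballean X) (F : Ballean Y) (Φ : Set (X × Y)) : Prop :=
  ∀ ε ∈ E.radii, ∃ δ ∈ F.radii, ∀ x x' y y', (x, x') ∈ ε → (x, y) ∈ Φ → (x', y') ∈ Φ → (y, y') ∈ δ

/-- A coarse equivalence: a multi-map `Φ : X ⊸ Y` with `Φ⁻¹(Y) = X`, `Φ(X) = Y` such that both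
`Φ` and `Φ⁻¹` are coarse. -/
structure IsCoarseEquivalence {X Y : Type u} (E : Ballean X) (F : Ballean Y)
    (Φ : Set (X × Y)) : Prop where
  total : ∀ x, ∃ y, (x, y) ∈ Φ
  surj : ∀ y, ∃ x, (x, y) ∈ Φ
  coarse : IsCoarse E F Φ
  coarse_inv : IsCoarse F E (Prod.swap ⁻¹' Φ)

/-- Coarse equivalence of balleans. For nonempty balleans this means that they contain coarsely
isomorphic large subspaces, see `coarselyEquivalent_iff_large`. -/
def CoarselyEquivalent {X Y : Type u} (E : Ballean X) (F : Ballean Y) : Prop :=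
  ∃ Φ : Set (X × Y), IsCoarseEquivalence E F Φ

/-- A subset `L` is large if `X = B(L, ε)` for some radius `ε`. -/
def IsLarge {X : Type u} (E : Ballean X) (L : Set X) : Prop :=
  ∃ ε ∈ E.radii, entNhd L ε = Set.univ

/-- A coarse map: every radius of `X` is mapped into some radius of `Y`. -/
def IsCoarseMap {X Y : Type u} (E : Ballean X) (F : Ballean Y) (f : X → Y) : Prop :=
  ∀ ε ∈ E.radii, ∃ δ ∈ F.radii, ∀ x x', (x, x') ∈ ε → (f x, f x') ∈ δ

/-- Coarsely isomorphic balleans: there is a bijection which is coarse together with its inverse. -/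
def CoarselyIsomorphic {X Y : Type u} (E : Ballean X) (F : Ballean Y) : Prop :=
  ∃ e : X ≃ Y, IsCoarseMap E F e ∧ IsCoarseMap F E e.symm

theorem radii_nonempty {X : Type u} [Nonempty X] (E : Ballean X) : E.radii.Nonempty := by
  obtain ⟨x⟩ := ‹Nonempty X›
  have h : (x, x) ∈ ⋃₀ E.radii := by rw [E.sUnion_radii]; trivial
  obtain ⟨ε, hε, -⟩ := h
  exact ⟨ε, hε⟩

theorem isCoarse_aux {X Y : Type u} (E : Ballean X) (F : Ballean Y) {L : Set X} {M : Set Y}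
    (e : L → M) (he : IsCoarseMap (E.sub L) (F.sub M) e) {ε : Set (X × X)} {δ : Set (Y × Y)}
    (hε : ε ∈ E.radii) (hδ : δ ∈ F.radii) :
    IsCoarse E F {p | ∃ l : L, ((l : X), p.1) ∈ ε ∧ ((e l : Y), p.2) ∈ δ} := by
  intro α hα
  obtain ⟨β, hβ, h1⟩ := E.comp_le ε hε α hα
  obtain ⟨γ, hγ, h2⟩ := E.comp_le β hβ ε hε
  obtain ⟨_, ⟨η, hη, rfl⟩, h3⟩ := he _ ⟨γ, hγ, rfl⟩
  obtain ⟨θ, hθ, h4⟩ := F.comp_le δ hδ η hη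
  obtain ⟨ζ, hζ, h5⟩ := F.comp_le θ hθ δ hδ
  refine ⟨ζ, hζ, ?_⟩
  rintro x x' y y' hx ⟨l, hl, hy⟩ ⟨l', hl', hy'⟩
  have hm : ((e l : Y), (e l' : Y)) ∈ η :=
    h3 l l' (h2 ⟨x', h1 ⟨x, hl, hx⟩, (E.isEntourage ε hε).symm _ _ hl'⟩)
  exact h5 ⟨_, h4 ⟨_, (F.isEntourage δ hδ).symm _ _ hy, hm⟩, hy'⟩

/-- Two nonempty balleans are coarsely equivalent if and only if they contain coarsely isomorphic
large subspaces. -/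
theorem coarselyEquivalent_iff_large {X Y : Type u} [Nonempty X] [Nonempty Y]
    (E : Ballean X) (F : Ballean Y) :
    CoarselyEquivalent E F ↔ ∃ (L : Set X) (M : Set Y), E.IsLarge L ∧ F.IsLarge M ∧
      CoarselyIsomorphic (E.sub L) (F.sub M) := by
  constructor
  · rintro ⟨Φ, ht, hs, hc, hi⟩
    choose f hf using ht
    obtain ⟨ε₀, hε₀⟩ := E.radii_nonempty
    obtain ⟨δ₀, hδ₀⟩ := F.radii_nonempty
    have hg : ∀ y : Set.range f, ∃ x, f x = y := fun y => y.2
    choose g hg using hg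
    refine ⟨Set.range g, Set.range f, ?_, ?_, ?_⟩
    · obtain ⟨η, hη, h⟩ := hi δ₀ hδ₀
      refine ⟨η, hη, Set.eq_univ_of_forall fun x => ?_⟩
      refine Set.mem_iUnion₂.2 ⟨g ⟨f x, x, rfl⟩, ⟨_, rfl⟩, ?_⟩
      refine h (f x) (f x) _ _ ((F.isEntourage δ₀ hδ₀).refl _) ?_ (hf x)
      have := hf (g ⟨f x, x, rfl⟩)
      rwa [hg] at this
    · obtain ⟨η, hη, h⟩ := hc ε₀ hε₀
      refine ⟨η, hη, Set.eq_univ_of_forall fun y => ?_⟩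
      obtain ⟨x, hx⟩ := hs y
      exact Set.mem_iUnion₂.2 ⟨f x, ⟨x, rfl⟩,
        h x x _ _ ((E.isEntourage ε₀ hε₀).refl _) (hf x) hx⟩
    · refine ⟨⟨fun x => ⟨f x, x, rfl⟩, fun y => ⟨g y, y, rfl⟩, ?_, ?_⟩, ?_, ?_⟩
      · rintro ⟨_, y, rfl⟩
        refine Subtype.ext ?_
        exact congrArg g (Subtype.ext (hg y))
      · intro y
        exact Subtype.ext (hg y)
      · rintro _ ⟨ε, hε, rfl⟩
        obtain ⟨δ, hδ, h⟩ := hc ε hε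
        exact ⟨_, ⟨δ, hδ, rfl⟩, fun x x' hx => h x x' _ _ hx (hf _) (hf _)⟩
      · rintro _ ⟨ε, hε, rfl⟩
        obtain ⟨δ, hδ, h⟩ := hi ε hε
        refine ⟨_, ⟨δ, hδ, rfl⟩, fun y y' hy => h y y' _ _ hy ?_ ?_⟩
        · have := hf (g y)
          rwa [hg] at this
        · have := hf (g y')
          rwa [hg] at this
  · rintro ⟨L, M, ⟨ε, hε, hL⟩, ⟨δ, hδ, hM⟩, e, he, he'⟩
    have hL' : ∀ x, ∃ l : L, ((l : X), x) ∈ ε := fun x => by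
      have hx : x ∈ entNhd L ε := by rw [hL]; trivial
      obtain ⟨l, hl, h⟩ := Set.mem_iUnion₂.1 hx
      exact ⟨⟨l, hl⟩, h⟩
    have hM' : ∀ y, ∃ m : M, ((m : Y), y) ∈ δ := fun y => by
      have hy : y ∈ entNhd M δ := by rw [hM]; trivial
      obtain ⟨m, hm, h⟩ := Set.mem_iUnion₂.1 hy
      exact ⟨⟨m, hm⟩, h⟩
    refine ⟨{p | ∃ l : L, ((l : X), p.1) ∈ ε ∧ ((e l : Y), p.2) ∈ δ}, ?_, ?_, ?_, ?_⟩
    · intro x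
      obtain ⟨l, hl⟩ := hL' x
      exact ⟨e l, l, hl, (F.isEntourage δ hδ).refl _⟩
    · intro y
      obtain ⟨m, hm⟩ := hM' y
      refine ⟨e.symm m, e.symm m, (E.isEntourage ε hε).refl _, ?_⟩
      simpa using hm
    · exact isCoarse_aux E F e he hε hδ
    · have h := isCoarse_aux F E e.symm he' hδ hε
      convert h using 1
      ext ⟨y, x⟩
      constructor
      · rintro ⟨l, h1, h2⟩
        exact ⟨e l, h2, by simpa using h1⟩
      · rintro ⟨m, h1, h2⟩
        exact ⟨e.symm m, h2, by simpa using h1⟩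

end Ballean

/-! In a cellular ballean the radii may be replaced by cells, the equivalence relations contained in
some radius, and covering numbers then become numbers of classes of one cell inside a class of
another. If the ballean is also ordinal, fewer than `cof` cells have a common upper bound. As the
cofinalities agree, transfinite recursion gives increasing cofinal chains of cells in both balleans
over the same well-order (`exists_pair_chain`).

Such a chain is a tree. Its branching at index `i` is the number of classes of the union of the
earlier members (`below`) inside a class of the `i`-th member. If the branching of the first tree
never exceeds that of the second at the same index, a recursion along a well-order of `X` gives a
map preserving and reflecting all relations; if the branchings are equal, the image meets every
smallest class (`exists_chain_embedding`). It remains to choose the chains well.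

For the embedding, let `e` be a cell witnessing `covSharp` of `X`. At each stage the number of
`e`-classes in a class of the current cell of `X` is bounded below `covFlat` of `Y`, so the next
cell of `Y` can be made to branch at least that much.

For the equivalence, let `c` be the common covering number. If `c` is finite, both balleans are
bounded. If `c` is uncountable, every stage can be given the same infinite branching `M < c` on both
sides: infinite sets split into parts of size `M`, and `M * M = M` absorbs the earlier stages.

The delicate case is `c = ℵ₀`. The cofinality is then countable and classes are finite modulo `e`,
but of varying sizes, so exact branching meets divisibility obstructions. They are avoided by
prescribing for each class only how many pieces it will be cut into, the number of `e`-classes per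
piece being free in an interval `[b, a]`. Working from the top down, this freedom suffices to make
finite chains exactly homogeneous, with branching depending only on numbers shared by `X` and `Y`.
An ultrafilter limit turns the finite chains into an infinite one. -/

open Cardinal Set Setoid

/-! ### Counting classes of equivalence relations. -/

namespace Setoid

/-- The equivalence class of `x`. -/
def ball {X : Type u} (s : Setoid X) (x : X) : Set X := {y | s x y}

/-- The set of classes of `s` that meet `A`. -/
def classesOn {X : Type u} (s : Setoid X) (A : Set X) : Set (Quotient s) := Quotient.mk s '' A

theorem mem_ball_self {X : Type u} (s : Setoid X) (x : X) : x ∈ s.ball x := s.refl x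

theorem ball_eq {X : Type u} {s : Setoid X} {x y : X} (h : s x y) : s.ball x = s.ball y := by
  ext z
  exact ⟨fun hz => s.trans (s.symm h) hz, fun hz => s.trans h hz⟩

theorem mk_mem_classesOn {X : Type u} {s : Setoid X} {A : Set X} {x : X} (hx : x ∈ A) :
    Quotient.mk s x ∈ s.classesOn A := ⟨x, hx, rfl⟩

theorem mk_classesOn_pos {X : Type u} (s : Setoid X) {A : Set X} {x : X} (hx : x ∈ A) :
    1 ≤ #(s.classesOn A) :=
  Cardinal.one_le_iff_ne_zero.2 <|
    Cardinal.mk_ne_zero_iff.2 ⟨⟨_, mk_mem_classesOn (s := s) hx⟩⟩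

theorem mk_classesOn_ball_self {X : Type u} (s : Setoid X) (x : X) :
    #(s.classesOn (s.ball x)) = 1 := by
  have : s.classesOn (s.ball x) = {Quotient.mk s x} := by
    ext q
    constructor
    · rintro ⟨y, hy, rfl⟩
      exact Quotient.sound (s.symm hy)
    · rintro rfl
      exact mk_mem_classesOn (s.mem_ball_self x)
  rw [this, Cardinal.mk_singleton]

/-- A coarser equivalence has fewer classes on a given set. -/
theorem classesOn_map {X : Type u} {r s : Setoid X} (h : r ≤ s) (A : Set X) :
    s.classesOn A = (Quotient.map' (s₁ := r) (s₂ := s) id fun _ _ hxy => h hxy) '' r.classesOn A := by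
  ext q
  constructor
  · rintro ⟨x, hx, rfl⟩
    exact ⟨_, ⟨x, hx, rfl⟩, rfl⟩
  · rintro ⟨_, ⟨x, hx, rfl⟩, rfl⟩
    exact ⟨x, hx, rfl⟩

theorem mk_classesOn_anti {X : Type u} {r s : Setoid X} (h : r ≤ s) (A : Set X) :
    #(s.classesOn A) ≤ #(r.classesOn A) := by
  rw [classesOn_map h]
  exact Cardinal.mk_image_le

theorem mk_classesOn_mono {X : Type u} (s : Setoid X) {A B : Set X} (h : A ⊆ B) :
    #(s.classesOn A) ≤ #(s.classesOn B) :=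
  Cardinal.mk_le_mk_of_subset (Set.image_mono h)

theorem mk_classesOn_congr {X : Type u} {r s : Setoid X} {A : Set X}
    (h : ∀ x ∈ A, ∀ y ∈ A, r x y ↔ s x y) : #(r.classesOn A) = #(s.classesOn A) := by
  have key : ∀ {r s : Setoid X}, (∀ x ∈ A, ∀ y ∈ A, r x y ↔ s x y) →
      #(r.classesOn A) ≤ #(s.classesOn A) := by
    intro r s h
    choose f hf using fun q : r.classesOn A => q.2
    refine Cardinal.mk_le_of_injective
      (f := fun q => (⟨Quotient.mk s (f q), f q, (hf q).1, rfl⟩ : s.classesOn A)) ?_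
    intro p q hpq
    have h1 : s (f p) (f q) := Quotient.exact (congrArg Subtype.val hpq)
    have h2 := Quotient.sound ((h _ (hf p).1 _ (hf q).1).2 h1)
    exact Subtype.ext (by rw [← (hf p).2, ← (hf q).2]; exact h2)
  exact le_antisymm (key h) (key fun x hx y hy => (h x hx y hy).symm)

/-- If every class of `s` meeting `A` contains at most `c` classes of `r`,
then the number of classes of `r` on `A` is at most `c` times that of `s`. -/
theorem mk_classesOn_le_mul {X : Type u} {r s : Setoid X} {A : Set X} {c : Cardinal.{u}}
    (h : ∀ x, #(r.classesOn (s.ball x)) ≤ c) :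
    #(r.classesOn A) ≤ #(s.classesOn A) * c := by
  have hsub : r.classesOn A ⊆ ⋃ q ∈ s.classesOn A, r.classesOn (s.ball q.out) := by
    rintro _ ⟨x, hx, rfl⟩
    refine Set.mem_biUnion (mk_mem_classesOn hx) (mk_mem_classesOn ?_)
    exact Quotient.mk_out (s := s) x
  refine (Cardinal.mk_le_mk_of_subset hsub).trans ((Cardinal.mk_biUnion_le _ _).trans ?_)
  exact mul_le_mul_right (ciSup_le' fun q => h _) _

/-- The union of the members of an increasing chain of equivalences with index below `i`;
for the least index it is the least member of the chain. -/
def below {X : Type u} {I : Type*} [LinearOrder I] [OrderBot I] (ε : I → Setoid X)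
    (hε : Monotone ε) (i : I) : Setoid X where
  r x y := ∃ j, (j < i ∨ j = ⊥) ∧ ε j x y
  iseqv := by
    refine ⟨fun x => ⟨⊥, Or.inr rfl, (ε ⊥).refl x⟩, ?_, ?_⟩
    · rintro x y ⟨j, hj, h⟩
      exact ⟨j, hj, (ε j).symm h⟩
    · rintro x y z ⟨j, hj, h⟩ ⟨k, hk, h'⟩
      rcases le_total j k with hjk | hjk
      · exact ⟨k, hk, (ε k).trans (hε hjk h) h'⟩
      · exact ⟨j, hj, (ε j).trans h (hε hjk h')⟩

section below

variable {X : Type u} {I : Type*} [LinearOrder I] [OrderBot I] {ε : I → Setoid X}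
  {hε : Monotone ε}

theorem below_le_self (i : I) : below ε hε i ≤ ε i := by
  rintro x y ⟨j, hj, h⟩
  rcases hj with hj | rfl
  · exact hε hj.le h
  · exact hε bot_le h

theorem bot_le_below (i : I) : ε ⊥ ≤ below ε hε i := fun _ _ h => ⟨⊥, Or.inr rfl, h⟩

theorem le_below {i j : I} (h : i < j) : ε i ≤ below ε hε j := fun _ _ h' => ⟨i, Or.inl h, h'⟩

theorem below_bot : below ε hε ⊥ = ε ⊥ := le_antisymm (below_le_self _) (bot_le_below _)

theorem below_le {i : I} (hi : i ≠ ⊥) {s : Setoid X} (h : ∀ j < i, ε j ≤ s) :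
    below ε hε i ≤ s := by
  rintro x y ⟨j, hj, h'⟩
  rcases hj with hj | rfl
  · exact h j hj h'
  · exact h ⊥ (bot_lt_iff_ne_bot.2 hi) h'

end below

end Setoid


/-! ### Mapping one chain of equivalences into another. -/

/-- Between pointed sets of comparable cardinality there is a pointed injection,
which is surjective if the cardinalities are equal. -/
theorem exists_pointed_injOn {α β : Type u} {A : Set α} {B : Set β} {a : α} {b : β}
    (ha : a ∈ A) (hb : b ∈ B) (h : #A ≤ #B) :
    ∃ φ : α → β, MapsTo φ A B ∧ InjOn φ A ∧ φ a = b ∧ (#A = #B → SurjOn φ A B) := by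
  classical
  obtain ⟨g, hg, hs⟩ : ∃ g : A → B, Function.Injective g ∧ (#A = #B → Function.Surjective g) := by
    by_cases he : #A = #B
    · obtain ⟨e⟩ := Cardinal.eq.1 he
      exact ⟨e, e.injective, fun _ => e.surjective⟩
    · obtain ⟨e⟩ := Cardinal.le_def _ _ |>.1 h
      exact ⟨e, e.injective, fun h => absurd h he⟩
  -- A transposition of the target corrects any injection to one that respects the base points.
  let σ : Equiv.Perm B := Equiv.swap (g ⟨a, ha⟩) ⟨b, hb⟩
  refine ⟨fun x => if hx : x ∈ A then σ (g ⟨x, hx⟩) else b, ?_, ?_, ?_, ?_⟩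
  · intro x hx
    simp only [hx, dite_true]
    exact Subtype.coe_prop _
  · intro x hx y hy hxy
    simp only [hx, hy, dite_true] at hxy
    exact congrArg Subtype.val (hg (σ.injective (Subtype.ext hxy)))
  · simp [ha, σ]
  · intro he y hy
    obtain ⟨x, hx⟩ := hs he (σ.symm ⟨y, hy⟩)
    refine ⟨x, x.2, ?_⟩
    simp [hx]

/-- A well-founded version of choice along first occurrences: a map `f` defined on a well-ordered
set such that `f x` is prescribed in terms of the value of `f` at an earlier point. -/
theorem exists_map_of_wellFounded {X Y : Type u} [LinearOrder X] [WellFoundedLT X] [Nonempty Y]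
    (R : X → X → Prop) (hR : ∀ x d, R x d → d < x) (hu : ∀ x d d', R x d → R x d' → d = d')
    (G : X → Y → Y) : ∃ f : X → Y, ∀ x d, R x d → f x = G x (f d) := by
  classical
  let F : (x : X) → ((y : X) → y < x → Y) → Y := fun x ih =>
    if h : ∃ d, R x d then G x (ih h.choose (hR _ _ h.choose_spec)) else Classical.arbitrary Y
  refine ⟨WellFounded.fix wellFounded_lt F, fun x d hd => ?_⟩
  have h : ∃ d, R x d := ⟨d, hd⟩
  rw [WellFounded.fix_eq]
  simp only [F, h, dite_true]
  rw [hu x _ _ h.choose_spec hd]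

theorem exists_isLeast_of_nonempty {α : Type*} [LinearOrder α] [WellFoundedLT α] {s : Set α}
    (hs : s.Nonempty) : ∃ a, IsLeast s a :=
  ⟨_, WellFounded.min_mem wellFounded_lt _ hs, fun _ hy => WellFounded.min_le wellFounded_lt hy⟩

/-- Two chains of equivalences such that every class of the first one splits into at most as many
classes as every class of the second one of the same index: there is a map that preserves and
reflects all equivalences. If the numbers are equal, then its image meets all the smallest classes
of the second chain. -/
theorem exists_chain_embedding {X Y : Type u} {I : Type*} [LinearOrder I] [OrderBot I]
    [WellFoundedLT I] [Nonempty Y] (ε : I → Setoid X) (δ : I → Setoid Y)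
    (hε : Monotone ε) (hδ : Monotone δ) (hX : ∀ x x', ∃ i, ε i x x')
    (hcard : ∀ i x y, #((below ε hε i).classesOn ((ε i).ball x)) ≤
      #((below δ hδ i).classesOn ((δ i).ball y))) :
    ∃ f : X → Y, (∀ i x x', ε i x x' ↔ δ i (f x) (f x')) ∧
      ((∀ i x y, #((below ε hε i).classesOn ((ε i).ball x)) =
        #((below δ hδ i).classesOn ((δ i).ball y))) → Nonempty X → (∀ y y', ∃ i, δ i y y') →
        ∀ y, ∃ x, δ ⊥ (f x) y) := by
  classical
  obtain ⟨_, _⟩ := exists_wellFoundedLT X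
  choose φ hmaps hinj hφ hsurj using fun (i : I) (d : X) (y : Y) =>
    exists_pointed_injOn (mk_mem_classesOn (s := below ε hε i) ((ε i).mem_ball_self d))
      (mk_mem_classesOn (s := below δ hδ i) ((δ i).mem_ball_self y)) (hcard i d y)
  -- `i` is the first index for which `x` has an earlier relative, and `d` is its least relative
  let L : X → I → X → Prop := fun x i d =>
    IsLeast {i | ∃ d < x, ε i d x} i ∧ IsLeast ((ε i).ball x) d
  have hLlt : ∀ x i d, L x i d → d < x := by
    rintro x i d ⟨⟨⟨e, he, hex⟩, -⟩, hd⟩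
    exact (hd.2 ((ε i).symm hex)).trans_lt he
  have hLu : ∀ x i d i' d', L x i d → L x i' d' → i = i' ∧ d = d' := by
    rintro x i d i' d' ⟨h1, h2⟩ ⟨h3, h4⟩
    obtain rfl := h1.unique h3
    exact ⟨rfl, h2.unique h4⟩
  have hmin : ∀ (s : Setoid X) x, ∃ d, IsLeast (s.ball x) d := fun s x =>
    exists_isLeast_of_nonempty ⟨x, s.mem_ball_self x⟩
  -- Only the class of `f x` modulo `below δ hδ i` matters, so any representative is taken. A point
  -- without earlier relatives gets an arbitrary value.
  obtain ⟨f, hf⟩ : ∃ f : X → Y, ∀ x i d, L x i d →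
      Quotient.mk (below δ hδ i) (f x) = φ i d (f d) (Quotient.mk (below ε hε i) x) := by
    let G : X → Y → Y := fun x y =>
      if h : ∃ i d, L x i d then
        (φ h.choose h.choose_spec.choose y (Quotient.mk _ x)).out else y
    obtain ⟨f, hf⟩ := exists_map_of_wellFounded (Y := Y) (fun x d => ∃ i, L x i d)
      (fun x d ⟨i, h⟩ => hLlt x i d h) (fun x d d' ⟨i, h⟩ ⟨i', h'⟩ => (hLu x i d i' d' h h').2) G
    refine ⟨f, fun x i d h => ?_⟩
    rw [hf x d ⟨i, h⟩]
    have h' : ∃ i d, L x i d := ⟨i, d, h⟩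
    simp only [G, h', dite_true]
    obtain ⟨h1, h2⟩ := hLu x _ _ i d h'.choose_spec.choose_spec h
    generalize h'.choose_spec.choose = d' at h2 ⊢
    generalize h'.choose = i' at h1 ⊢
    subst h1 h2
    exact Quotient.out_eq _
  have hstep : ∀ x i d, L x i d → δ i (f x) (f d) := by
    intro x i d h
    have hx : Quotient.mk (below ε hε i) x ∈ (below ε hε i).classesOn ((ε i).ball d) :=
      mk_mem_classesOn ((ε i).symm h.2.1)
    have := hmaps i d (f d) hx
    rw [← hf x i d h] at this
    obtain ⟨y, hy, hyx⟩ := this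
    exact (δ i).symm ((δ i).trans hy (below_le_self i (Quotient.exact hyx)))
  have hex : ∀ x i d, IsLeast ((ε i).ball x) d → d ≠ x → ∃ j e, j ≤ i ∧ L x j e := by
    intro x i d hd hdx
    have hlt : d < x := lt_of_le_of_ne (hd.2 ((ε i).mem_ball_self x)) hdx
    have hne : {i | ∃ d < x, ε i d x}.Nonempty := ⟨i, d, hlt, (ε i).symm hd.1⟩
    obtain ⟨j, hj⟩ := exists_isLeast_of_nonempty hne
    obtain ⟨e, he⟩ := hmin (ε j) x
    exact ⟨j, e, hj.2 ⟨d, hlt, (ε i).symm hd.1⟩, hj, he⟩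
  have hcenter : ∀ i x d, IsLeast ((ε i).ball x) d → δ i (f x) (f d) := by
    intro i x
    induction x using WellFoundedLT.induction with
    | ind x ih =>
      intro d hd
      by_cases hdx : d = x
      · rw [hdx]
      obtain ⟨j, e, hji, hL⟩ := hex x i d hd hdx
      refine (δ i).trans (hδ hji (hstep x j e hL)) (ih e (hLlt _ _ _ hL) d ?_)
      rwa [← ball_eq (hε hji hL.2.1)]
  have hfwd : ∀ i x x', ε i x x' → δ i (f x) (f x') := by
    intro i x x' h
    obtain ⟨d, hd⟩ := hmin (ε i) x
    exact (δ i).trans (hcenter i x d hd) ((δ i).symm (hcenter i x' d (ball_eq h ▸ hd)))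
  have hfwd' : ∀ i x x', below ε hε i x x' → below δ hδ i (f x) (f x') := by
    rintro i x x' ⟨j, hj, h⟩
    exact ⟨j, hj, hfwd j x x' h⟩
  -- The defining formula extends from first occurrences to all indices. Replace `x` by the least
  -- point `z` of its `below`-class. Either `z` is the centre `d`, where `φ` is pointed, or `i` is
  -- the first index at which `z` has an earlier relative.
  have hφf : ∀ i x d, IsLeast ((ε i).ball x) d →
      Quotient.mk (below δ hδ i) (f x) = φ i d (f d) (Quotient.mk (below ε hε i) x) := by
    intro i x d hd
    obtain ⟨z, hz⟩ := hmin (below ε hε i) x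
    have hzd : IsLeast ((ε i).ball z) d := by rwa [← ball_eq (below_le_self (hε := hε) i hz.1)]
    have h1 : Quotient.mk (below δ hδ i) (f x) = Quotient.mk _ (f z) :=
      Quotient.sound (hfwd' i x z hz.1)
    have h2 : Quotient.mk (below ε hε i) x = Quotient.mk _ z := Quotient.sound hz.1
    rw [h1, h2]
    by_cases hdz : d = z
    · subst hdz
      exact (hφ i d (f d)).symm
    obtain ⟨j, e, hji, hL⟩ := hex z i d hzd hdz
    have hez : ¬ below ε hε i x e := fun h => (hLlt _ _ _ hL).not_ge (hz.2 h)
    have hij : i = j := by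
      by_contra hne
      exact hez ((below ε hε i).trans hz.1 (le_below (lt_of_le_of_ne hji (Ne.symm hne)) hL.2.1))
    subst hij
    obtain rfl := hL.2.unique hzd
    exact hf z i e hL
  refine ⟨f, fun i x x' => ⟨hfwd i x x', fun h => ?_⟩, ?_⟩
  -- At the first index `k` joining `x` and `x'` they have the same centre but different
  -- `below`-classes, which the injection `φ` keeps apart.
  · by_contra hn
    obtain ⟨k, hk⟩ : ∃ k, IsLeast {k | ε k x x'} k :=
      exists_isLeast_of_nonempty (hX x x')
    have hik : i < k := lt_of_not_ge fun hki => hn (hε hki hk.1)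
    obtain ⟨d, hd⟩ := hmin (ε k) x
    have hd' : IsLeast ((ε k).ball x') d := by rwa [← ball_eq hk.1]
    have he : Quotient.mk (below δ hδ k) (f x) = Quotient.mk _ (f x') :=
      Quotient.sound (le_below hik h)
    rw [hφf k x d hd, hφf k x' d hd'] at he
    have := hinj k d (f d) (mk_mem_classesOn ((ε k).symm hd.1))
      (mk_mem_classesOn ((ε k).symm hd'.1)) he
    obtain ⟨j, hj, hjx⟩ := Quotient.exact this
    have hjk := hk.2 hjx
    rcases hj with hj | rfl
    · exact hj.not_ge hjk
    · exact (bot_le.trans_lt hik).not_ge hjk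
  · rintro heq ⟨x₀⟩ hY y
    -- Descent on the index: surjectivity of `φ` replaces `x` by a point whose image is related to
    -- `y` at a smaller index, or already at `⊥`.
    have key : ∀ k x, δ k (f x) y → ∃ x', δ ⊥ (f x') y := by
      intro k
      induction k using WellFoundedLT.induction with
      | ind k ih =>
        intro x hxy
        obtain ⟨d, hd⟩ := hmin (ε k) x
        have hdy : y ∈ (δ k).ball (f d) := (δ k).trans ((δ k).symm (hcenter k x d hd)) hxy
        obtain ⟨_, ⟨x₁, hx₁, rfl⟩, h⟩ :=
          hsurj k d (f d) (heq k d (f d)) (mk_mem_classesOn (s := below δ hδ k) hdy)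
        have hd₁ : IsLeast ((ε k).ball x₁) d := by
          rw [← ball_eq (show ε k d x₁ from hx₁), ← ball_eq (show ε k x d from hd.1)]
          exact hd
        rw [← hφf k x₁ d hd₁] at h
        obtain ⟨j, hj, hjx⟩ := Quotient.exact h
        rcases hj with hj | rfl
        · exact ih j hj x₁ hjx
        · exact ⟨x₁, hjx⟩
    obtain ⟨k, hk⟩ := hY (f x₀) y
    exact key k x₀ hk

/-! ### Cells, and the cardinal invariants expressed through them. -/

namespace Ballean

/-- The equivalence relations that are contained in some radius. -/
def cells {X : Type u} (E : Ballean X) : Set (Setoid X) :=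
  {s | ∃ ε ∈ E.radii, ∀ x y, s x y → (x, y) ∈ ε}

section

variable {X : Type u} {E : Ballean X}

theorem cells_mono {s t : Setoid X} (h : s ≤ t) (ht : t ∈ E.cells) : s ∈ E.cells := by
  obtain ⟨ε, hε, h'⟩ := ht
  exact ⟨ε, hε, fun x y hxy => h' x y (h hxy)⟩

theorem IsCellular.exists_cell (hE : E.IsCellular) {ε : Set (X × X)} (hε : ε ∈ E.radii) :
    ∃ s ∈ E.cells, ∀ x y, (x, y) ∈ ε → s x y := by
  obtain ⟨𝓑, ⟨hsub, hbase⟩, hcell⟩ := hE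
  obtain ⟨δ, hδ, hle⟩ := hbase ε ⟨E.isEntourage ε hε, ε, hε, subset_rfl⟩
  obtain ⟨-, η, hη, hδη⟩ := hsub hδ
  have h := hcell δ hδ
  exact ⟨⟨fun x y => (x, y) ∈ δ, h.refl, fun h' => h.symm _ _ h', fun h1 h2 => h.trans _ _ _ h1 h2⟩,
    ⟨η, hη, fun x y hxy => hδη hxy⟩, fun x y hxy => hle hxy⟩

theorem exists_radius_ge (E : Ballean X) {ε δ : Set (X × X)} (hε : ε ∈ E.radii)
    (hδ : δ ∈ E.radii) : ∃ η ∈ E.radii, ε ⊆ η ∧ δ ⊆ η := by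
  obtain ⟨η, hη, h⟩ := E.comp_le ε hε δ hδ
  exact ⟨η, hη, fun p hp => h ⟨p.2, hp, (E.isEntourage δ hδ).refl _⟩,
    fun p hp => h ⟨p.1, (E.isEntourage ε hε).refl _, hp⟩⟩

theorem IsCellular.exists_cell_ge (hE : E.IsCellular) {s t : Setoid X} (hs : s ∈ E.cells)
    (ht : t ∈ E.cells) : ∃ r ∈ E.cells, s ≤ r ∧ t ≤ r := by
  obtain ⟨ε, hε, hs⟩ := hs
  obtain ⟨δ, hδ, ht⟩ := ht
  obtain ⟨η, hη, h1, h2⟩ := E.exists_radius_ge hε hδ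
  obtain ⟨r, hr, h⟩ := hE.exists_cell hη
  exact ⟨r, hr, fun x y hxy => h _ _ (h1 (hs _ _ hxy)), fun x y hxy => h _ _ (h2 (ht _ _ hxy))⟩

theorem IsCellular.exists_cell_rel (hE : E.IsCellular) (x y : X) : ∃ s ∈ E.cells, s x y := by
  have h : (x, y) ∈ ⋃₀ E.radii := by rw [E.sUnion_radii]; trivial
  obtain ⟨ε, hε, h⟩ := h
  obtain ⟨s, hs, h'⟩ := hE.exists_cell hε
  exact ⟨s, hs, h' _ _ h⟩

theorem mem_coarseStructure_of_cell {s : Setoid X} (hs : s ∈ E.cells) :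
    {p : X × X | s p.1 p.2} ∈ E.coarseStructure := by
  obtain ⟨ε, hε, h⟩ := hs
  exact ⟨⟨fun x => s.refl x, fun x y hxy => s.symm hxy⟩, ε, hε, fun p hp => h _ _ hp⟩

theorem exists_isBase_mk_eq_cof (E : Ballean X) : ∃ 𝓑, E.IsBase 𝓑 ∧ #𝓑 = E.cof :=
  csInf_mem (s := {κ | ∃ 𝓑 : Set (Set (X × X)), E.IsBase 𝓑 ∧ #𝓑 = κ})
    ⟨_, E.coarseStructure, ⟨subset_rfl, fun ε hε => ⟨ε, hε, subset_rfl⟩⟩, rfl⟩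

theorem IsBase.cof_le {𝓑 : Set (Set (X × X))} (h : E.IsBase 𝓑) : E.cof ≤ #𝓑 :=
  csInf_le' ⟨𝓑, h, rfl⟩

theorem IsCellular.exists_cofinal (hE : E.IsCellular) :
    ∃ c : E.cof.ord.ToType → Setoid X, (∀ i, c i ∈ E.cells) ∧ ∀ s ∈ E.cells, ∃ i, s ≤ c i := by
  obtain ⟨𝓑, hB, hcard⟩ := E.exists_isBase_mk_eq_cof
  obtain ⟨e⟩ : Nonempty (E.cof.ord.ToType ≃ 𝓑) := by
    rw [← Cardinal.eq, Cardinal.mk_ord_toType, hcard]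
  have : ∀ ε : 𝓑, ∃ s ∈ E.cells, ∀ x y, (x, y) ∈ (ε : Set (X × X)) → s x y := by
    intro ε
    obtain ⟨-, η, hη, hle⟩ := hB.1 ε.2
    obtain ⟨s, hs, h⟩ := hE.exists_cell hη
    exact ⟨s, hs, fun x y hxy => h _ _ (hle hxy)⟩
  choose c hc hle using this
  refine ⟨fun i => c (e i), fun i => hc _, fun s hs => ?_⟩
  obtain ⟨δ, hδ, h⟩ := hB.2 _ (mem_coarseStructure_of_cell hs)
  refine ⟨e.symm ⟨δ, hδ⟩, fun x y hxy => ?_⟩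
  change c (e (e.symm ⟨δ, hδ⟩)) x y
  rw [e.apply_symm_apply]
  exact hle _ _ _ (h hxy)

/-- In an ordinal ballean fewer than `cof` equivalences have a common upper bound. -/
theorem IsOrdinal.exists_upper_bound (hE : E.IsOrdinal) (hc : E.IsCellular) {ι : Type u}
    (hι : #ι < E.cof) (S : ι → Setoid X) (hS : ∀ i, S i ∈ E.cells) :
    ∃ s ∈ E.cells, ∀ i, S i ≤ s := by
  obtain ⟨κ, b, hb, hmono, hsub, hbase⟩ := hE
  have : ∀ i, ∃ α < κ, {p : X × X | S i p.1 p.2} ⊆ b α := by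
    intro i
    obtain ⟨_, ⟨α, hα, rfl⟩, h⟩ := hbase _ (mem_coarseStructure_of_cell (hS i))
    exact ⟨α, hα, h⟩
  choose α hα hle using this
  -- If the `α i` were unbounded, the relations `b (α i)` would form a base with fewer than `cof`
  -- members.
  obtain ⟨β, hβ, hαβ⟩ : ∃ β < κ, ∀ i, α i < β := by
    by_contra! hcon
    refine (hι.trans_le (IsBase.cof_le (𝓑 := range fun i => b (α i)) ⟨?_, ?_⟩)).not_ge mk_range_le
    · rintro _ ⟨i, rfl⟩
      exact hsub ⟨_, hα i, rfl⟩
    · intro ε hε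
      obtain ⟨_, ⟨β, hβ, rfl⟩, h⟩ := hbase ε hε
      obtain ⟨i, hi⟩ := hcon β hβ
      refine ⟨_, ⟨i, rfl⟩, h.trans ?_⟩
      rcases hi.eq_or_lt with rfl | hlt
      · exact subset_rfl
      · exact hmono _ _ hlt (hα i)
  obtain ⟨s, hs, h⟩ := hc.exists_cell (hb β hβ)
  exact ⟨s, hs, fun i x y hxy => h _ _ (hmono _ _ (hαβ i) hβ (hle i hxy))⟩

theorem entCov_le_mk_classesOn {s : Setoid X} {ε : Set (X × X)}
    (h : ∀ x y, s x y → (x, y) ∈ ε) (A : Set X) : entCov ε A ≤ #(s.classesOn A) := by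
  refine le_trans (b := #(Quotient.out '' s.classesOn A)) ?_ mk_image_le
  refine csInf_le' ⟨Quotient.out '' s.classesOn A, rfl, fun x hx => ?_⟩
  exact mem_iUnion₂.2 ⟨_, ⟨_, mk_mem_classesOn hx, rfl⟩, h _ _ (Quotient.mk_out (s := s) x)⟩

theorem mk_classesOn_le_entCov {s : Setoid X} {ε : Set (X × X)} (hε : IsEntourage ε)
    (h : ∀ x y, (x, y) ∈ ε → s x y) (A : Set X) : #(s.classesOn A) ≤ entCov ε A := by
  obtain ⟨C, hC, hA⟩ := csInf_mem (s := {κ | ∃ C : Set X, #C = κ ∧ A ⊆ entNhd C ε})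
    ⟨_, A, rfl, fun x hx => mem_iUnion₂.2 ⟨x, hx, hε.refl x⟩⟩
  rw [entCov, ← hC]
  refine (mk_le_mk_of_subset (t := Quotient.mk s '' C) ?_).trans mk_image_le
  rintro _ ⟨x, hx, rfl⟩
  obtain ⟨c, hc, hcx⟩ := mem_iUnion₂.1 (hA hx)
  exact ⟨c, hc, Quotient.sound (h _ _ hcx)⟩

/-- Cardinals are well-ordered, so the infimum defining `covSharp` is attained; enlarging the
witnessing radius to a cell only lowers the counts. -/
theorem IsCellular.exists_lt_covSharp [Nonempty X] (hE : E.IsCellular) :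
    ∃ e ∈ E.cells, ∀ s ∈ E.cells, ⨆ x, #(e.classesOn (s.ball x)) < E.covSharp := by
  obtain ⟨ε₀, hε₀⟩ := E.radii_nonempty
  obtain ⟨ε, hε, h⟩ := csInf_mem
    (s := {κ | ∃ ε ∈ E.radii, ∀ δ ∈ E.radii, (⨆ x : X, entCov ε (entBall x δ)) < κ})
    -- The successor of the supremum over all relations shows that the infimum is over a nonempty
    -- set.
    ⟨Order.succ (⨆ δ : Set (X × X), ⨆ x : X, entCov ε₀ (entBall x δ)), ε₀, hε₀, fun δ _ =>
      Order.lt_succ_of_le <| le_ciSup (f := fun δ => ⨆ x : X, entCov ε₀ (entBall x δ))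
        (bddAbove_of_small) δ⟩
  obtain ⟨e, he, hle⟩ := hE.exists_cell hε
  refine ⟨e, he, fun s hs => ?_⟩
  obtain ⟨δ, hδ, hsδ⟩ := hs
  refine (ciSup_mono bddAbove_of_small fun x => ?_).trans_lt (h δ hδ)
  exact (mk_classesOn_mono e fun y hy => hsδ _ _ hy).trans
    (mk_classesOn_le_entCov (E.isEntourage ε hε) hle _)

theorem IsCellular.exists_le_of_lt_covFlat (hE : E.IsCellular) {μ : Cardinal.{u}}
    (hμ : μ < E.covFlat) {s : Setoid X} (hs : s ∈ E.cells) :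
    ∃ t ∈ E.cells, s ≤ t ∧ ∀ x, μ ≤ #(s.classesOn (t.ball x)) := by
  obtain ⟨κ, hκ, hlt⟩ := exists_lt_of_lt_csSup' hμ
  obtain ⟨ε, hε, hsε⟩ := id hs
  obtain ⟨δ, hδ, h⟩ := hκ μ hlt ε hε
  obtain ⟨t, ht, htδ⟩ := hE.exists_cell hδ
  obtain ⟨r, hr, hsr, htr⟩ := hE.exists_cell_ge hs ht
  refine ⟨r, hr, hsr, fun x => (h.trans (ciInf_le' _ x)).trans
    ((entCov_le_mk_classesOn hsε _).trans (mk_classesOn_mono s fun y hy => ?_))⟩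
  exact htr (htδ _ _ hy)

theorem exists_radius_eq_univ_of_top_mem_cells (h : ⊤ ∈ E.cells) : Set.univ ∈ E.radii := by
  obtain ⟨ε, hε, h⟩ := h
  rwa [← eq_univ_of_forall (s := ε) fun p => h p.1 p.2 trivial]

/-- The multi-map relates `x` to every point `η`-close to `f x`, where `η` measures how dense the
image is. Two further compositions with `η` account for this thickening. -/
theorem coarselyEquivalent_of_map {Y : Type u} {F : Ballean Y} (f : X → Y)
    (hf : IsCoarseMap E F f)
    (hf' : ∀ δ ∈ F.radii, ∃ ε ∈ E.radii, ∀ x x', (f x, f x') ∈ δ → (x, x') ∈ ε)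
    (hd : ∃ δ ∈ F.radii, ∀ y, ∃ x, (f x, y) ∈ δ) : CoarselyEquivalent E F := by
  obtain ⟨η, hη, hd⟩ := hd
  refine ⟨{p | (f p.1, p.2) ∈ η}, fun x => ⟨f x, (F.isEntourage η hη).refl _⟩, hd, ?_, ?_⟩
  · intro ε hε
    obtain ⟨δ, hδ, h⟩ := hf ε hε
    obtain ⟨θ, hθ, h1⟩ := F.comp_le η hη δ hδ
    obtain ⟨ζ, hζ, h2⟩ := F.comp_le θ hθ η hη
    exact ⟨ζ, hζ, fun x x' y y' hx hy hy' =>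
      h2 ⟨f x', h1 ⟨f x, (F.isEntourage η hη).symm _ _ hy, h _ _ hx⟩, hy'⟩⟩
  · intro δ hδ
    obtain ⟨θ, hθ, h1⟩ := F.comp_le η hη δ hδ
    obtain ⟨ζ, hζ, h2⟩ := F.comp_le θ hθ η hη
    obtain ⟨ε, hε, h⟩ := hf' ζ hζ
    exact ⟨ε, hε, fun y y' x x' hy hx hx' =>
      h _ _ (h2 ⟨y', h1 ⟨y, hx, hy⟩, (F.isEntourage η hη).symm _ _ hx'⟩)⟩

theorem IsCellular.coarselyEquivalent_sub {Y : Type u} {F : Ballean Y} (hE : E.IsCellular)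
    (hF : F.IsCellular) (hr : F.radii.Nonempty) (f : X → Y)
    (hf : ∀ s ∈ E.cells, ∃ t ∈ F.cells, ∀ x x', s x x' → t (f x) (f x'))
    (hf' : ∀ t ∈ F.cells, ∃ s ∈ E.cells, ∀ x x', t (f x) (f x') → s x x') :
    CoarselyEquivalent E (F.sub (range f)) := by
  refine coarselyEquivalent_of_map (fun x => ⟨f x, x, rfl⟩) ?_ ?_ ?_
  · intro ε hε
    obtain ⟨s, hs, hεs⟩ := hE.exists_cell hε
    obtain ⟨t, ⟨δ, hδ, htδ⟩, h⟩ := hf s hs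
    exact ⟨_, ⟨δ, hδ, rfl⟩, fun x x' hx => htδ _ _ (h _ _ (hεs _ _ hx))⟩
  · rintro _ ⟨δ, hδ, rfl⟩
    obtain ⟨t, ht, hδt⟩ := hF.exists_cell hδ
    obtain ⟨s, ⟨ε, hε, hsε⟩, h⟩ := hf' t ht
    exact ⟨ε, hε, fun x x' hx => hsε _ _ (h _ _ (hδt _ _ hx))⟩
  · obtain ⟨δ, hδ⟩ := hr
    refine ⟨_, ⟨δ, hδ, rfl⟩, ?_⟩
    rintro ⟨_, x, rfl⟩
    exact ⟨x, (F.isEntourage δ hδ).refl _⟩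

theorem IsCellular.coarselyEquivalent {Y : Type u} {F : Ballean Y} (hE : E.IsCellular)
    (hF : F.IsCellular) (f : X → Y)
    (hf : ∀ s ∈ E.cells, ∃ t ∈ F.cells, ∀ x x', s x x' → t (f x) (f x'))
    (hf' : ∀ t ∈ F.cells, ∃ s ∈ E.cells, ∀ x x', t (f x) (f x') → s x x')
    (hd : ∃ t ∈ F.cells, ∀ y, ∃ x, t (f x) y) : CoarselyEquivalent E F := by
  refine coarselyEquivalent_of_map f ?_ ?_ ?_
  · intro ε hε
    obtain ⟨s, hs, hεs⟩ := hE.exists_cell hε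
    obtain ⟨t, ⟨δ, hδ, htδ⟩, h⟩ := hf s hs
    exact ⟨δ, hδ, fun x x' hx => htδ _ _ (h _ _ (hεs _ _ hx))⟩
  · intro δ hδ
    obtain ⟨t, ht, hδt⟩ := hF.exists_cell hδ
    obtain ⟨s, ⟨ε, hε, hsε⟩, h⟩ := hf' t ht
    exact ⟨ε, hε, fun x x' hx => hsε _ _ (h _ _ (hδt _ _ hx))⟩
  · obtain ⟨t, ⟨δ, hδ, htδ⟩, h⟩ := hd
    refine ⟨δ, hδ, fun y => ?_⟩
    obtain ⟨x, hx⟩ := h y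
    exact ⟨x, htδ _ _ hx⟩

end

end Ballean

/-! ### Transfinite chains and intermediate equivalences. -/

/-- Transfinite construction of a chain: at every step one first passes to an upper bound of all
previous members and of a prescribed element, and then to a larger element with property `R`. -/
theorem exists_chain {P : Type*} [Preorder P] {I : Type*} [LinearOrder I] [WellFoundedLT I]
    (hub : ∀ (i : I) (h : Iio i → P), ∃ p, ∀ j, h j ≤ p) (hdir : ∀ p q : P, ∃ r, p ≤ r ∧ q ≤ r)
    (c : I → P) (R : I → P → P → Prop) (hR : ∀ i p, ∃ q, p ≤ q ∧ R i p q) :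
    ∃ g p : I → P, Monotone g ∧
      ∀ i, (∀ j < i, g j ≤ p i) ∧ c i ≤ p i ∧ p i ≤ g i ∧ R i (p i) (g i) := by
  choose ub hub using hub
  choose join hj1 hj2 using hdir
  choose next hn1 hn2 using hR
  let F : (i : I) → ((j : I) → j < i → P) → P := fun i ih =>
    join (ub i fun j => ih j j.2) (c i)
  let g : I → P := WellFounded.fix wellFounded_lt fun i ih => next i (F i ih)
  let p : I → P := fun i => F i fun j _ => g j
  have hg : ∀ i, g i = next i (p i) := fun i => WellFounded.fix_eq _ _ _
  have h1 : ∀ i, ∀ j < i, g j ≤ p i := fun i j hj =>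
    (hub i (fun j => g j) ⟨j, hj⟩).trans (hj1 _ _)
  have h2 : ∀ i, p i ≤ g i := fun i => by rw [hg]; exact hn1 _ _
  refine ⟨g, p, ?_, fun i => ⟨h1 i, hj2 _ _, h2 i, by rw [hg]; exact hn2 _ _⟩⟩
  intro i j hij
  rcases hij.eq_or_lt with rfl | hlt
  · exact le_rfl
  · exact (h1 j i hlt).trans (h2 j)

namespace Setoid

/-- Refine `t` by a labelling of the classes of `p` inside every class of `t`. -/
def split {X L : Type*} (p t : Setoid X) (g : Quotient t → Quotient p → L) : Setoid X :=
  ker fun x => (Quotient.mk t x, g (Quotient.mk t x) (Quotient.mk p x))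

section split

variable {X : Type u} {L : Type*} {p t : Setoid X} {g : Quotient t → Quotient p → L}

theorem split_iff {x y : X} : split p t g x y ↔ t x y ∧
    g (Quotient.mk t x) (Quotient.mk p x) = g (Quotient.mk t x) (Quotient.mk p y) := by
  rw [split, ker_def, Prod.mk.injEq, Quotient.eq]
  refine and_congr_right fun h => ?_
  rw [← Quotient.sound h]

theorem split_le : split p t g ≤ t := fun _ _ h => (split_iff.1 h).1

theorem le_split (h : p ≤ t) : p ≤ split p t g := fun x y hxy =>
  split_iff.2 ⟨h hxy, by rw [Quotient.sound hxy]⟩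

theorem classesOn_split_ball (x : X) : p.classesOn ((split p t g).ball x) =
    {q ∈ p.classesOn (t.ball x) | g (Quotient.mk t x) q = g (Quotient.mk t x) (Quotient.mk p x)} := by
  ext q
  constructor
  · rintro ⟨y, hy, rfl⟩
    obtain ⟨h1, h2⟩ := split_iff.1 hy
    exact ⟨mk_mem_classesOn h1, h2.symm⟩
  · rintro ⟨⟨y, hy, rfl⟩, h⟩
    exact mk_mem_classesOn (split_iff.2 ⟨hy, h.symm⟩)

end split

end Setoid

/-- A set of infinite cardinality at least `M` splits into parts of cardinality `M`. -/
theorem exists_fibers_eq {α : Type u} (T : Set α) {M : Cardinal.{u}} (hM : ℵ₀ ≤ M) (hT : M ≤ #T) :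
    ∃ g : α → α, ∀ a ∈ T, #{q ∈ T | g q = g a} = M := by
  classical
  -- Labelling by the first coordinate of a bijection of `T` with `T × M` makes every fibre a copy
  -- of `M`.
  have h : #T = #(T × M.out) := by
    rw [mk_prod, lift_id, lift_id, mk_out,
      mul_eq_left (hM.trans hT) hT (aleph0_pos.trans_le hM).ne']
  obtain ⟨e⟩ := Cardinal.eq.1 h
  refine ⟨fun q => if hq : q ∈ T then ((e ⟨q, hq⟩).1 : α) else q, fun a ha => ?_⟩
  refine Eq.trans (mk_congr (β := M.out) ⟨fun q => (e ⟨q, q.2.1⟩).2,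
    fun m => ⟨e.symm ((e ⟨a, ha⟩).1, m), Subtype.coe_prop _, ?_⟩, ?_, ?_⟩)
    (mk_out M)
  · simp [ha]
  · rintro ⟨q, hq, h⟩
    simp only [hq, ha, dite_true] at h
    refine Subtype.ext ?_
    have : ((e ⟨a, ha⟩).1, (e ⟨q, hq⟩).2) = e ⟨q, hq⟩ := by
      rw [← Subtype.ext h]
    simp [this]
  · intro m
    simp

/-- If every class of `t` consists of at least `M` classes of `p`, where `M` is infinite, then
some intermediate equivalence has classes that consist of exactly `M` classes of `p`. -/
theorem exists_intermediate_eq {X : Type u} {p t : Setoid X} (h : p ≤ t) {M : Cardinal.{u}}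
    (hM : ℵ₀ ≤ M) (hc : ∀ x, M ≤ #(p.classesOn (t.ball x))) :
    ∃ q, p ≤ q ∧ q ≤ t ∧ ∀ x, #(p.classesOn (q.ball x)) = M := by
  choose g hg using fun c : Quotient t => exists_fibers_eq (p.classesOn (t.ball c.out)) hM (hc _)
  refine ⟨split p t g, le_split h, split_le, fun x => ?_⟩
  rw [classesOn_split_ball]
  have hb : t.ball (Quotient.mk t x).out = t.ball x := ball_eq (Quotient.mk_out (s := t) x)
  have := hg (Quotient.mk t x) (Quotient.mk p x)
  rw [hb] at this
  exact this (mk_mem_classesOn (t.mem_ball_self x))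

/-! ### The embedding, and the equivalence for uncountable covering number. -/

namespace Ballean

section

variable {X Y : Type u} {E : Ballean X} {F : Ballean Y}

theorem IsOrdinal.exists_upper_bound_Iio (hE : E.IsOrdinal) (hc : E.IsCellular)
    {κ : Cardinal.{u}} (hκ : E.cof = κ) (i : κ.ord.ToType) (h : Iio i → {s // s ∈ E.cells}) :
    ∃ s : {s // s ∈ E.cells}, ∀ j, h j ≤ s := by
  have hi : #(Iio i) < E.cof := by simpa [hκ] using mk_Iio_lt i (by simp)
  obtain ⟨s, hs, hle⟩ := hE.exists_upper_bound hc hi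
    (fun j => (h j : Setoid X)) fun j => (h j).2
  exact ⟨⟨s, hs⟩, hle⟩

/-- Simultaneous construction of cofinal chains of equivalences in two ordinal balleans. -/
theorem exists_pair_chain (hEc : E.IsCellular) (hEo : E.IsOrdinal) (hFc : F.IsCellular)
    (hFo : F.IsOrdinal) {κ : Cardinal.{u}} (hκ : E.cof = κ) (hκ' : F.cof = κ)
    {e : Setoid X} {e' : Setoid Y} (he : e ∈ E.cells) (he' : e' ∈ F.cells)
    (R : Setoid X → Setoid Y → Setoid X → Setoid Y → Prop)
    (hR : ∀ p ∈ E.cells, ∀ p' ∈ F.cells,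
      ∃ q ∈ E.cells, ∃ q' ∈ F.cells, p ≤ q ∧ p' ≤ q' ∧ R p p' q q') :
    ∃ (ε p : κ.ord.ToType → Setoid X) (δ p' : κ.ord.ToType → Setoid Y),
      (Monotone ε ∧ Monotone δ) ∧ ((∀ i, ε i ∈ E.cells) ∧ ∀ i, δ i ∈ F.cells) ∧
      ((∀ s ∈ E.cells, ∃ i, s ≤ ε i) ∧ ∀ s ∈ F.cells, ∃ i, s ≤ δ i) ∧
      ∀ i, (∀ j < i, ε j ≤ p i ∧ δ j ≤ p' i) ∧ (e ≤ p i ∧ e' ≤ p' i) ∧ (p i ≤ ε i ∧ p' i ≤ δ i) ∧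
        R (p i) (p' i) (ε i) (δ i) := by
  obtain ⟨c, hc, hcc⟩ : ∃ c : κ.ord.ToType → Setoid X,
      (∀ i, c i ∈ E.cells) ∧ ∀ s ∈ E.cells, ∃ i, s ≤ c i := hκ ▸ hEc.exists_cofinal
  obtain ⟨c', hc', hcc'⟩ : ∃ c : κ.ord.ToType → Setoid Y,
      (∀ i, c i ∈ F.cells) ∧ ∀ s ∈ F.cells, ∃ i, s ≤ c i := hκ' ▸ hFc.exists_cofinal
  -- Joining the cofinal family with `e` and `e'` keeps all stages above them.
  choose d hd hcd hed using fun i => hEc.exists_cell_ge (hc i) he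
  choose d' hd' hcd' hed' using fun i => hFc.exists_cell_ge (hc' i) he'
  obtain ⟨g, p, hg, h⟩ := exists_chain (P := {s // s ∈ E.cells} × {s // s ∈ F.cells})
    (I := κ.ord.ToType)
    (fun i h => by
      obtain ⟨s, hs⟩ := hEo.exists_upper_bound_Iio hEc hκ i fun j => (h j).1
      obtain ⟨t, ht⟩ := hFo.exists_upper_bound_Iio hFc hκ' i fun j => (h j).2
      exact ⟨(s, t), fun j => ⟨hs j, ht j⟩⟩)
    (fun p q => by
      obtain ⟨s, hs, h1, h2⟩ := hEc.exists_cell_ge p.1.2 q.1.2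
      obtain ⟨t, ht, h3, h4⟩ := hFc.exists_cell_ge p.2.2 q.2.2
      exact ⟨(⟨s, hs⟩, ⟨t, ht⟩), ⟨h1, h3⟩, ⟨h2, h4⟩⟩)
    (fun i => (⟨d i, hd i⟩, ⟨d' i, hd' i⟩)) (fun _ p q => R p.1 p.2 q.1 q.2)
    (fun _ p => by
      obtain ⟨s, hs, t, ht, h1, h2, h3⟩ := hR _ p.1.2 _ p.2.2
      exact ⟨(⟨s, hs⟩, ⟨t, ht⟩), ⟨h1, h2⟩, h3⟩)
  refine ⟨fun i => (g i).1, fun i => (p i).1, fun i => (g i).2, fun i => (p i).2,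
    ⟨fun i j hij => (hg hij).1, fun i j hij => (hg hij).2⟩,
    ⟨fun i => (g i).1.2, fun i => (g i).2.2⟩, ⟨fun s hs => ?_, fun s hs => ?_⟩, fun i => ?_⟩
  · obtain ⟨i, hi⟩ := hcc s hs
    exact ⟨i, hi.trans ((hcd i).trans ((h i).2.1.1.trans (h i).2.2.1.1))⟩
  · obtain ⟨i, hi⟩ := hcc' s hs
    exact ⟨i, hi.trans ((hcd' i).trans ((h i).2.1.2.trans (h i).2.2.1.2))⟩
  · obtain ⟨h1, h2, h3, h4⟩ := h i
    exact ⟨fun j hj => h1 j hj, ⟨(hed i).trans h2.1, (hed' i).trans h2.2⟩, h3, h4⟩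

section chain

variable {I : Type*} [LinearOrder I] [OrderBot I] [WellFoundedLT I] {ε : I → Setoid X}
  {δ : I → Setoid Y}

theorem exists_coarselyEquivalent_sub_of_chain [Nonempty Y] (hEc : E.IsCellular)
    (hFc : F.IsCellular)
    (hε : Monotone ε) (hδ : Monotone δ) (hεE : ∀ i, ε i ∈ E.cells) (hδF : ∀ i, δ i ∈ F.cells)
    (hεc : ∀ s ∈ E.cells, ∃ i, s ≤ ε i) (hδc : ∀ s ∈ F.cells, ∃ i, s ≤ δ i)
    (hcard : ∀ i x y, #((below ε hε i).classesOn ((ε i).ball x)) ≤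
      #((below δ hδ i).classesOn ((δ i).ball y))) :
    ∃ A : Set Y, CoarselyEquivalent E (F.sub A) := by
  obtain ⟨f, hf, -⟩ := exists_chain_embedding ε δ hε hδ (fun x x' => by
    obtain ⟨s, hs, h⟩ := hEc.exists_cell_rel x x'
    obtain ⟨i, hi⟩ := hεc s hs
    exact ⟨i, hi h⟩) hcard
  refine ⟨range f, hEc.coarselyEquivalent_sub hFc F.radii_nonempty f (fun s hs => ?_)
    fun s hs => ?_⟩
  · obtain ⟨i, hi⟩ := hεc s hs
    exact ⟨δ i, hδF i, fun x x' h => (hf i x x').1 (hi h)⟩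
  · obtain ⟨i, hi⟩ := hδc s hs
    exact ⟨ε i, hεE i, fun x x' h => (hf i x x').2 (hi h)⟩

theorem coarselyEquivalent_of_chain [Nonempty X] [Nonempty Y] (hEc : E.IsCellular)
    (hFc : F.IsCellular)
    (hε : Monotone ε) (hδ : Monotone δ) (hεE : ∀ i, ε i ∈ E.cells) (hδF : ∀ i, δ i ∈ F.cells)
    (hεc : ∀ s ∈ E.cells, ∃ i, s ≤ ε i) (hδc : ∀ s ∈ F.cells, ∃ i, s ≤ δ i)
    (hcard : ∀ i x y, #((below ε hε i).classesOn ((ε i).ball x)) =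
      #((below δ hδ i).classesOn ((δ i).ball y))) :
    CoarselyEquivalent E F := by
  obtain ⟨f, hf, hd⟩ := exists_chain_embedding ε δ hε hδ (fun x x' => by
    obtain ⟨s, hs, h⟩ := hEc.exists_cell_rel x x'
    obtain ⟨i, hi⟩ := hεc s hs
    exact ⟨i, hi h⟩) fun i x y => (hcard i x y).le
  refine hEc.coarselyEquivalent hFc f (fun s hs => ?_) (fun s hs => ?_) ⟨δ ⊥, hδF ⊥, ?_⟩
  · obtain ⟨i, hi⟩ := hεc s hs
    exact ⟨δ i, hδF i, fun x x' h => (hf i x x').1 (hi h)⟩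
  · obtain ⟨i, hi⟩ := hδc s hs
    exact ⟨ε i, hεE i, fun x x' h => (hf i x x').2 (hi h)⟩
  · refine hd hcard ‹_› fun y y' => ?_
    obtain ⟨s, hs, h⟩ := hFc.exists_cell_rel y y'
    obtain ⟨i, hi⟩ := hδc s hs
    exact ⟨i, hi h⟩

end chain

/-- A cellular ordinal ballean embeds coarsely into another one of the same cofinality
with larger covering numbers. -/
theorem exists_coarselyEquivalent_sub [Nonempty X] [Nonempty Y] (hEc : E.IsCellular)
    (hEo : E.IsOrdinal) (hFc : F.IsCellular) (hFo : F.IsOrdinal) (hcof : E.cof = F.cof)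
    (h : E.covSharp ≤ F.covFlat) : ∃ A : Set Y, CoarselyEquivalent E (F.sub A) := by
  obtain ⟨e, he, hlt⟩ := hEc.exists_lt_covSharp
  obtain ⟨δ₀, hδ₀⟩ := F.radii_nonempty
  obtain ⟨e', he', -⟩ := hFc.exists_cell hδ₀
  obtain ⟨ε, p, δ, p', ⟨hε, hδ⟩, ⟨hεE, hδF⟩, ⟨hεc, hδc⟩, hch⟩ :=
    exists_pair_chain hEc hEo hFc hFo rfl hcof.symm he he'
      -- The cell of `X` is kept (`q = p`) and only that of `Y` is enlarged: the supremum of the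
      -- counts over `p` is below `covSharp` of `X`, hence below `covFlat` of `Y`.
      (fun p p' q q' => ∀ x y, #(e.classesOn (q.ball x)) ≤ #(p'.classesOn (q'.ball y)))
      (fun p hp p' hp' => by
        obtain ⟨q', hq', hle, hc⟩ := hFc.exists_le_of_lt_covFlat ((hlt p hp).trans_le h) hp'
        exact ⟨p, hp, q', hq', le_rfl, hle, fun x y =>
          (le_ciSup (bddAbove_of_small) x).trans (hc y)⟩)
  obtain ⟨i₀, -⟩ := hεc e he
  have : Nonempty E.cof.ord.ToType := ⟨i₀⟩
  let _ : OrderBot E.cof.ord.ToType := WellFoundedLT.toOrderBot _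
  refine exists_coarselyEquivalent_sub_of_chain hEc hFc hε hδ hεE hδF hεc hδc fun i x y => ?_
  by_cases hi : i = ⊥
  · subst hi
    rw [below_bot, below_bot, mk_classesOn_ball_self, mk_classesOn_ball_self]
  obtain ⟨h1, h2, h3, h4⟩ := hch i
  -- The counts are squeezed because `e` lies under the union of the earlier `ε j`, while `p' i`
  -- lies above that of the earlier `δ j`.
  have hle : e ≤ below ε hε i := ((hch ⊥).2.1.1.trans (hch ⊥).2.2.1.1).trans
    (bot_le_below i)
  exact (mk_classesOn_anti hle _).trans ((h4 x y).trans
    (mk_classesOn_anti (below_le hi fun j hj => (h1 j hj).2) _))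

/-- If the common value of the covering numbers is uncountable, then one can choose chains
in which the number of subclasses of all classes of given index is the same. -/
theorem coarselyEquivalent_of_aleph0_lt [Nonempty X] [Nonempty Y] (hEc : E.IsCellular)
    (hEo : E.IsOrdinal) (hFc : F.IsCellular) (hFo : F.IsOrdinal) (hcof : E.cof = F.cof)
    {c : Cardinal.{u}} (hc : ℵ₀ < c) (hE1 : E.covSharp = c) (hE2 : E.covFlat = c)
    (hF1 : F.covSharp = c) (hF2 : F.covFlat = c) : CoarselyEquivalent E F := by
  obtain ⟨e, he, hlt⟩ := hEc.exists_lt_covSharp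
  obtain ⟨e', he', hlt'⟩ := hFc.exists_lt_covSharp
  -- `M` bounds the numbers of `e`- and `e'`-classes of both current cells, so it can serve as
  -- branching on both sides. It stays below `c` because `c` is uncountable.
  let M : Setoid X → Setoid Y → Cardinal.{u} := fun p p' =>
    max ℵ₀ (max (⨆ x, #(e.classesOn (p.ball x))) (⨆ y, #(e'.classesOn (p'.ball y))))
  have hM1 : ∀ p p' x, #(e.classesOn (p.ball x)) ≤ M p p' := fun p p' x =>
    (le_ciSup (f := fun x => #(e.classesOn (p.ball x))) bddAbove_of_small x).trans
      ((le_max_left _ _).trans (le_max_right _ _))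
  have hM2 : ∀ p p' y, #(e'.classesOn (p'.ball y)) ≤ M p p' := fun p p' y =>
    (le_ciSup (f := fun y => #(e'.classesOn (p'.ball y))) bddAbove_of_small y).trans
      ((le_max_right _ _).trans (le_max_right _ _))
  have hM0 : ∀ p p', ℵ₀ ≤ M p p' := fun p p' => le_max_left _ _
  obtain ⟨ε, p, δ, p', ⟨hε, hδ⟩, ⟨hεE, hδF⟩, ⟨hεc, hδc⟩, hch⟩ :=
    exists_pair_chain hEc hEo hFc hFo rfl hcof.symm he he'
      (fun p p' q q' => (∀ x, #(p.classesOn (q.ball x)) = M p p') ∧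
        ∀ y, #(p'.classesOn (q'.ball y)) = M p p')
      (fun p hp p' hp' => by
        have hM : M p p' < c := max_lt hc (max_lt (hE1 ▸ hlt p hp) (hF1 ▸ hlt' p' hp'))
        obtain ⟨t, ht, h1, h2⟩ := hEc.exists_le_of_lt_covFlat (hE2.symm ▸ hM) hp
        obtain ⟨t', ht', h1', h2'⟩ := hFc.exists_le_of_lt_covFlat (hF2.symm ▸ hM) hp'
        obtain ⟨q, hq1, hq2, hq3⟩ := exists_intermediate_eq h1 (hM0 p p') h2
        obtain ⟨q', hq1', hq2', hq3'⟩ := exists_intermediate_eq h1' (hM0 p p') h2'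
        exact ⟨q, cells_mono hq2 ht, q', cells_mono hq2' ht', hq1, hq1', hq3, hq3'⟩)
  obtain ⟨i₀, -⟩ := hεc e he
  have : Nonempty E.cof.ord.ToType := ⟨i₀⟩
  let _ : OrderBot E.cof.ord.ToType := WellFoundedLT.toOrderBot _
  -- At most `N` classes of `r` in each class of `s`, and exactly `N` classes of `s`, give at most
  -- `N * N = N` classes of `below`; since `below` lies under `s`, there are at least `N`.
  have key : ∀ {Z : Type u} {ζ : E.cof.ord.ToType → Setoid Z} (hζ : Monotone ζ) {r s : Setoid Z}
      {i : E.cof.ord.ToType} {N : Cardinal.{u}}, i ≠ ⊥ → r ≤ ζ ⊥ → (∀ j < i, ζ j ≤ s) →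
      ℵ₀ ≤ N → (∀ z, #(r.classesOn (s.ball z)) ≤ N) → ∀ z, #(s.classesOn ((ζ i).ball z)) = N →
      #((below ζ hζ i).classesOn ((ζ i).ball z)) = N := by
    intro Z ζ hζ r s i N hi hr hs hN hrs z hz
    refine le_antisymm ?_ (hz ▸ mk_classesOn_anti (below_le hi hs) _)
    calc _ ≤ #(r.classesOn ((ζ i).ball z)) := mk_classesOn_anti (hr.trans (bot_le_below i)) _
      _ ≤ #(s.classesOn ((ζ i).ball z)) * N := mk_classesOn_le_mul hrs
      _ = N := by rw [hz, mul_eq_self hN]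
  refine coarselyEquivalent_of_chain hEc hFc hε hδ hεE hδF hεc hδc fun i x y => ?_
  by_cases hi : i = ⊥
  · subst hi
    rw [below_bot, below_bot, mk_classesOn_ball_self, mk_classesOn_ball_self]
  obtain ⟨h1, -, -, h4, h5⟩ := hch i
  obtain ⟨-, h2, h3, -⟩ := hch ⊥
  rw [key hε hi (h2.1.trans h3.1) (fun j hj => (h1 j hj).1) (hM0 _ _) (hM1 (p i) (p' i)) x (h4 x),
    key hδ hi (h2.2.trans h3.2) (fun j hj => (h1 j hj).2) (hM0 _ _) (hM2 (p i) (p' i)) y (h5 y)]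

end

end Ballean

/-! ### Integer combinatorics: even groups and adjustable multiplicities. -/

/-- The members of a finite family can be arranged one after the other: `pre i` is the sum of the
weights of the predecessors of `i`. -/
theorem exists_prefix_sums {α : Type*} (T : Finset α) (w : α → ℕ) {q : ℕ}
    (hw : ∀ i ∈ T, w i ≤ q) :
    ∃ pre : α → ℕ, (∀ i ∈ T, pre i + w i ≤ ∑ i ∈ T, w i) ∧ ∀ A ≤ ∑ i ∈ T, w i,
      A ≤ ∑ i ∈ T with pre i < A, w i ∧ ∑ i ∈ T with pre i < A, w i ≤ A + q := by
  classical
  induction T using Finset.induction_on with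
  | empty => exact ⟨fun _ => 0, by simp, by simp⟩
  | insert t T ht ih =>
    obtain ⟨pre, h1, h2⟩ := ih fun i hi => hw i (Finset.mem_insert_of_mem hi)
    have hne : ∀ i ∈ T, i ≠ t := fun i hi h => ht (h ▸ hi)
    have hf : ∀ A, ∑ i ∈ T with Function.update pre t (∑ i ∈ T, w i) i < A, w i =
        ∑ i ∈ T with pre i < A, w i := fun A => by
      refine Finset.sum_congr (Finset.filter_congr fun i hi => ?_) fun _ _ => rfl
      rw [Function.update_of_ne (hne i hi)]
    have hwt := hw t (Finset.mem_insert_self t T)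
    -- The new member is put last, after the total weight of the others.
    refine ⟨Function.update pre t (∑ i ∈ T, w i), ?_, ?_⟩
    · intro i hi
      rw [Finset.sum_insert ht]
      rcases Finset.mem_insert.1 hi with rfl | hi
      · rw [Function.update_self]
        omega
      · rw [Function.update_of_ne (hne i hi)]
        have := h1 i hi
        omega
    · intro A hA
      rw [Finset.sum_insert ht] at hA
      rw [Finset.filter_insert, Function.update_self]
      split_ifs with h
      · rw [Finset.sum_insert (by simp [ht]), hf,
          Finset.filter_true_of_mem fun i hi => lt_of_le_of_lt ((Nat.le_add_right _ _).trans (h1 i hi)) h]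
        omega
      · rw [hf]
        exact h2 A (not_lt.1 h)

/-- A finite family of weights at most `q` splits into `s` groups of almost equal total weights. -/
theorem exists_almost_equal_groups {α : Type*} (T : Finset α) (w : α → ℕ) {q s : ℕ}
    (hw : ∀ i ∈ T, w i ≤ q) (hpos : ∀ i ∈ T, 0 < w i) (hs : 0 < s) :
    ∃ g : α → ℕ, (∀ i ∈ T, g i < s) ∧ ∀ j < s,
      ∑ i ∈ T, w i ≤ s * (∑ i ∈ T with g i = j, w i) + s * q ∧
      s * (∑ i ∈ T with g i = j, w i) ≤ ∑ i ∈ T, w i + s * q := by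
  classical
  -- Scaling the weights by `s` makes the ideal cut points the integers `j * W`; group `j` consists
  -- of the members starting between `j * W` and `(j + 1) * W`.
  obtain ⟨pre, h1, h2⟩ := exists_prefix_sums T (fun i => s * w i) (q := s * q)
    fun i hi => Nat.mul_le_mul_left _ (hw i hi)
  rw [← Finset.mul_sum] at h1 h2
  set W := ∑ i ∈ T, w i with hW
  rcases T.eq_empty_or_nonempty with rfl | ⟨t, ht⟩
  · exact ⟨fun _ => 0, by simp, by simp [hW]⟩
  have hWpos : 0 < W := Finset.sum_pos hpos ⟨t, ht⟩
  refine ⟨fun i => pre i / W, fun i hi => ?_, fun j hj => ?_⟩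
  · rw [Nat.div_lt_iff_lt_mul hWpos]
    have := h1 i hi
    have := Nat.mul_pos hs (hpos i hi)
    omega
  · have key : ∑ i ∈ T with pre i < (j + 1) * W, s * w i =
        ∑ i ∈ T with pre i < j * W, s * w i + s * ∑ i ∈ T with pre i / W = j, w i := by
      rw [Finset.mul_sum (Finset.filter _ _), ← Finset.sum_union]
      · refine Finset.sum_congr ?_ fun _ _ => rfl
        ext i
        simp only [Finset.mem_filter, Finset.mem_union, ← and_or_left]
        refine and_congr_right fun _ => ?_
        rw [← Nat.div_lt_iff_lt_mul hWpos, ← Nat.div_lt_iff_lt_mul hWpos]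
        omega
      · rw [Finset.disjoint_filter]
        intro i _ h3 h4
        rw [← Nat.div_lt_iff_lt_mul hWpos] at h3
        omega
    have hj1 : (j + 1) * W ≤ s * W := Nat.mul_le_mul_right _ hj
    have hj2 : (j + 1) * W = j * W + W := by ring
    have h3 := h2 _ hj1
    have h4 := h2 (j * W) (by omega)
    rw [key] at h3
    beta_reduce
    omega

theorem exists_sum_eq_of_le {α : Type*} (T : Finset α) (l u : α → ℕ) (hlu : ∀ i ∈ T, l i ≤ u i)
    {M : ℕ} (hl : ∑ i ∈ T, l i ≤ M) (hu : M ≤ ∑ i ∈ T, u i) :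
    ∃ σ : α → ℕ, (∀ i ∈ T, l i ≤ σ i ∧ σ i ≤ u i) ∧ ∑ i ∈ T, σ i = M := by
  classical
  induction T using Finset.induction_on generalizing M with
  | empty => exact ⟨l, by simp, by simpa [eq_comm] using hu⟩
  | insert t T ht ih =>
    rw [Finset.sum_insert ht] at hl hu
    have hL : ∑ i ∈ T, l i ≤ ∑ i ∈ T, u i :=
      Finset.sum_le_sum fun i hi => hlu i (Finset.mem_insert_of_mem hi)
    have ht' := hlu t (Finset.mem_insert_self t T)
    obtain ⟨m, hm1, hm2, hm3, hm4, hm5⟩ : ∃ m, l t ≤ m ∧ m ≤ u t ∧ m ≤ M ∧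
        ∑ i ∈ T, l i ≤ M - m ∧ M - m ≤ ∑ i ∈ T, u i := by
      rcases le_total (M - ∑ i ∈ T, l i) (u t) with h | h
      · exact ⟨M - ∑ i ∈ T, l i, by omega, by omega, by omega, by omega, by omega⟩
      · exact ⟨u t, by omega, by omega, by omega, by omega, by omega⟩
    obtain ⟨σ, h1, h2⟩ := ih (fun i hi => hlu i (Finset.mem_insert_of_mem hi)) hm4 hm5
    refine ⟨Function.update σ t m, fun i hi => ?_, ?_⟩
    · rcases Finset.mem_insert.1 hi with rfl | hi
      · simp [hm1, hm2]
      · rw [Function.update_of_ne (ne_of_mem_of_not_mem hi ht)]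
        exact h1 i hi
    · rw [Finset.sum_insert ht, Function.update_self, Finset.sum_congr rfl fun i hi =>
        Function.update_of_ne (ne_of_mem_of_not_mem hi ht) m σ, h2]
      omega

/-- Large weights admit integer multiplicities with ratios in a subinterval of `[b, a]`. -/
theorem exists_multiplicity_bounds {a b w : ℕ} (hb : 0 < b) (hab : b < a) (hw : 3 * a ^ 2 ≤ w) :
    ∃ l u, l ≤ u ∧ w ≤ a * l ∧ b * u ≤ w ∧ l * (2 * a + b) ≤ 3 * w ∧ 3 * w ≤ u * (a + 2 * b) := by
  have ha : 0 < a := hb.trans hab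
  have hl1 : a * (w / a) ≤ w := Nat.mul_div_le w a
  have hl2 : w < a * (w / a + 1) := Nat.lt_mul_div_succ w ha
  have hu1 : b * (w / b) ≤ w := Nat.mul_div_le w b
  have hu2 : w < b * (w / b + 1) := Nat.lt_mul_div_succ w hb
  generalize w / a = l at *
  generalize w / b = u at *
  obtain ⟨d, rfl⟩ : ∃ d, a = b + d + 1 := ⟨a - b - 1, by omega⟩
  have h1 : (l + 1) * (2 * (b + d + 1) + b) ≤ 3 * w := by
    refine Nat.le_of_mul_le_mul_left (c := b + d + 1) ?_ ha
    nlinarith [Nat.zero_le (d * w)]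
  have h2 : 3 * w ≤ u * (b + d + 1 + 2 * b) := by
    refine Nat.le_of_mul_le_mul_left (c := b) ?_ hb
    nlinarith [Nat.zero_le (d * w)]
  -- The witnesses are `⌊w / a⌋ + 1` and `⌊w / b⌋`. The numbers `(a + 2b) / 3` and `(2a + b) / 3`
  -- trisect `[b, a]`, and `3 * a ^ 2 ≤ w` leaves room for rounding.
  refine ⟨l + 1, u, ?_, hl2.le, hu1, h1, h2⟩
  refine Nat.le_of_mul_le_mul_right (c := 2 * (b + d + 1) + b) ?_ (by omega)
  nlinarith

/-- Distribution of weights into `s` groups, and a choice of multiplicities of the weights such that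
the sum of multiplicities is the same number in all groups. -/
theorem exists_groups_multiplicities {α : Type*} (T : Finset α) (w : α → ℕ) {a b q s : ℕ}
    (hb : 0 < b) (hab : b < a) (hw : ∀ i ∈ T, 3 * a ^ 2 ≤ w i ∧ w i ≤ q)
    (h1 : ((a + 2 * b) * (2 * q + 1) + q) * s ≤ ∑ i ∈ T, w i)
    (h2 : ∑ i ∈ T, w i ≤ ((2 * a + b) * (2 * q + 1) - q) * s) (hs : 0 < s) :
    ∃ g σ : α → ℕ, (∀ i ∈ T, g i < s) ∧ (∀ i ∈ T, b * σ i ≤ w i ∧ w i ≤ a * σ i) ∧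
      ∀ j < s, ∑ i ∈ T with g i = j, σ i = 3 * (2 * q + 1) := by
  classical
  have ha : 0 < a := hb.trans hab
  obtain ⟨g, hg, hgs⟩ := exists_almost_equal_groups T w (fun i hi => (hw i hi).2)
    (fun i hi => lt_of_lt_of_le (by positivity) (hw i hi).1) hs
  have hlu : ∀ i, ∃ l u, i ∈ T → l ≤ u ∧ w i ≤ a * l ∧ b * u ≤ w i ∧
      l * (2 * a + b) ≤ 3 * w i ∧ 3 * w i ≤ u * (a + 2 * b) := by
    intro i
    by_cases hi : i ∈ T
    · obtain ⟨l, u, h⟩ := exists_multiplicity_bounds hb hab (hw i hi).1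
      exact ⟨l, u, fun _ => h⟩
    · exact ⟨0, 0, fun h => absurd h hi⟩
  choose l u hlu using hlu
  have hσ : ∀ j, ∃ σ : α → ℕ, j < s → (∀ i ∈ T.filter (g · = j), l i ≤ σ i ∧ σ i ≤ u i) ∧
      ∑ i ∈ T with g i = j, σ i = 3 * (2 * q + 1) := by
    intro j
    by_cases hj : j < s
    swap
    · exact ⟨l, fun h => absurd h hj⟩
    obtain ⟨h3, h4⟩ := hgs j hj
    -- The margins `q` in `h1` and `h2` absorb the unevenness of the groups. The bounds on the group
    -- weight then place `3 * (2 * q + 1)` between the sums of the `l i` and of the `u i`.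
    have h5 : (a + 2 * b) * (2 * q + 1) ≤ ∑ i ∈ T with g i = j, w i := by
      refine Nat.le_of_mul_le_mul_left (c := s) ?_ hs
      nlinarith
    have h6 : ∑ i ∈ T with g i = j, w i ≤ (2 * a + b) * (2 * q + 1) := by
      refine Nat.le_of_mul_le_mul_left (c := s) ?_ hs
      have : q ≤ (2 * a + b) * (2 * q + 1) := by nlinarith
      obtain ⟨z, hz⟩ := Nat.exists_eq_add_of_le this
      rw [hz, Nat.add_sub_cancel_left] at h2
      rw [hz]
      nlinarith
    have hl : (∑ i ∈ T with g i = j, l i) * (2 * a + b) ≤ 3 * ∑ i ∈ T with g i = j, w i := by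
      rw [Finset.sum_mul, Finset.mul_sum]
      exact Finset.sum_le_sum fun i hi => (hlu i (Finset.mem_filter.1 hi).1).2.2.2.1
    have hu : 3 * ∑ i ∈ T with g i = j, w i ≤ (∑ i ∈ T with g i = j, u i) * (a + 2 * b) := by
      rw [Finset.sum_mul, Finset.mul_sum]
      exact Finset.sum_le_sum fun i hi => (hlu i (Finset.mem_filter.1 hi).1).2.2.2.2
    obtain ⟨σ, hσ⟩ := exists_sum_eq_of_le (T.filter (g · = j)) l u
      (fun i hi => (hlu i (Finset.mem_filter.1 hi).1).1) (M := 3 * (2 * q + 1))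
      (Nat.le_of_mul_le_mul_right (c := 2 * a + b) (by linarith) (by omega))
      (Nat.le_of_mul_le_mul_right (c := a + 2 * b) (by linarith) (by omega))
    exact ⟨σ, fun _ => hσ⟩
  choose σ hσ using hσ
  refine ⟨g, fun i => σ (g i) i, hg, fun i hi => ?_, fun j hj => ?_⟩
  · obtain ⟨h3, h4⟩ := (hσ (g i) (hg i hi)).1 i (by simp [hi])
    obtain ⟨-, h5, h6, -⟩ := hlu i hi
    exact ⟨(Nat.mul_le_mul_left _ h4).trans h6, h5.trans (Nat.mul_le_mul_left _ h3)⟩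
  · rw [← (hσ j hj).2]
    refine Finset.sum_congr rfl fun i hi => ?_
    simp only [(Finset.mem_filter.1 hi).2]

/-! ### Homogeneous chains over towers with finite classes. -/

namespace Setoid

section

variable {X : Type u}

theorem finite_classesOn_of_le {r s : Setoid X} (h : r ≤ s) {A : Set X}
    (hf : (r.classesOn A).Finite) : (s.classesOn A).Finite := by
  rw [classesOn_map h]
  exact hf.image _

theorem ncard_classesOn_pos {s : Setoid X} {A : Set X} {x : X} (hx : x ∈ A)
    (hf : (s.classesOn A).Finite) : 0 < (s.classesOn A).ncard :=
  (ncard_pos hf).2 ⟨_, mk_mem_classesOn hx⟩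

/-- Counting classes of `r` along the classes of a coarser equivalence `s`. -/
theorem ncard_classesOn_eq_sum {r s : Setoid X} (h : r ≤ s) {A : Set X}
    (hA : ∀ x ∈ A, s.ball x ⊆ A) (hr : (r.classesOn A).Finite) {T : Finset (Quotient s)}
    (hT : (T : Set (Quotient s)) = s.classesOn A)
    {w : Quotient s → ℕ} (hw : ∀ x ∈ A, (r.classesOn (s.ball x)).ncard = w (Quotient.mk s x)) :
    (r.classesOn A).ncard = ∑ c ∈ T, w c := by
  classical
  let f : Quotient r → Quotient s := Quotient.map' (s₁ := r) (s₂ := s) id fun _ _ hxy => h hxy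
  rw [ncard_eq_toFinset_card _ hr, Finset.card_eq_sum_card_fiberwise (f := f) (t := T)]
  · refine Finset.sum_congr rfl fun c hc => ?_
    have hc' : c ∈ s.classesOn A := hT ▸ hc
    obtain ⟨x, hx, rfl⟩ := hc'
    rw [← hw x hx, ← ncard_coe_finset]
    congr 1
    ext d
    simp only [Finset.coe_filter, Finite.mem_toFinset, mem_ofPred_eq]
    constructor
    · rintro ⟨⟨y, hy, rfl⟩, hd⟩
      exact mk_mem_classesOn (s.symm (Quotient.exact hd))
    · rintro ⟨y, hy, rfl⟩
      exact ⟨mk_mem_classesOn (hA x hx hy), Quotient.sound (s.symm hy)⟩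
  · intro d hd
    rw [hT]
    obtain ⟨y, hy, rfl⟩ := (Finite.mem_toFinset hr).1 hd
    exact mk_mem_classesOn hy

/-- Inside one class of `t`, the classes of the splitting correspond to the labels in use. -/
theorem ncard_classesOn_split_ball {L : Type*} {p t : Setoid X} {g : Quotient t → Quotient p → L}
    (x : X) : ((split p t g).classesOn (t.ball x)).ncard =
      (g (Quotient.mk t x) '' p.classesOn (t.ball x)).ncard := by
  let F : X → Quotient t × L := fun x => (Quotient.mk t x, g (Quotient.mk t x) (Quotient.mk p x))
  have hinj : Function.Injective (Quotient.lift (s := split p t g) F fun _ _ h => h) := by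
    rintro ⟨x⟩ ⟨y⟩ h
    exact Quotient.sound h
  rw [← ncard_image_of_injective _ hinj,
    ← ncard_image_of_injective (_ '' p.classesOn (t.ball x))
      (Prod.mk_right_injective (Quotient.mk t x))]
  congr 1
  ext ⟨c, d⟩
  constructor
  · rintro ⟨_, ⟨y, hy, rfl⟩, h⟩
    refine ⟨_, ⟨_, mk_mem_classesOn hy, rfl⟩, ?_⟩
    rw [← h, Quotient.sound (show t x y from hy)]
    rfl
  · rintro ⟨_, ⟨_, ⟨y, hy, rfl⟩, rfl⟩, h⟩
    refine ⟨_, ⟨y, hy, rfl⟩, ?_⟩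
    rw [← h, Quotient.sound (show t x y from hy)]
    rfl

end

end Setoid

/-- Every positive number not exceeding the size of a finite set is the size of an image of it. -/
theorem exists_ncard_image_eq {α : Type*} {T : Set α} (hT : T.Finite) {m : ℕ} (hm : 0 < m)
    (hmT : m ≤ T.ncard) : ∃ g : α → ℕ, (g '' T).ncard = m := by
  classical
  obtain ⟨f, hf⟩ := countable_iff_exists_injOn.1 hT.countable
  obtain ⟨S, hS, rfl⟩ := exists_subset_card_eq hmT
  obtain ⟨a, ha⟩ := nonempty_of_ncard_ne_zero hm.ne'
  refine ⟨fun x => if x ∈ S then f x else f a, ?_⟩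
  rw [← (hf.mono hS).ncard_image]
  congr 1
  ext n
  constructor
  · rintro ⟨x, -, rfl⟩
    by_cases hx : x ∈ S
    · exact ⟨x, hx, by simp [hx]⟩
    · exact ⟨a, ha, by simp [hx]⟩
  · rintro ⟨x, hx, rfl⟩
    exact ⟨x, hS hx, by simp [hx]⟩

namespace Setoid

variable {X : Type u}

theorem exists_split_ncard {e t : Setoid X} (h : e ≤ t)
    (hfin : ∀ x, (e.classesOn (t.ball x)).Finite) (σ : X → ℕ) (hσ : ∀ x y, t x y → σ x = σ y)
    (hpos : ∀ x, 0 < σ x) (hle : ∀ x, σ x ≤ (e.classesOn (t.ball x)).ncard) :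
    ∃ q, e ≤ q ∧ q ≤ t ∧ ∀ x, (q.classesOn (t.ball x)).ncard = σ x := by
  choose g hg using fun c : Quotient t =>
    exists_ncard_image_eq (hfin c.out) (hpos c.out) (hle c.out)
  refine ⟨split e t g, le_split h, split_le, fun x => ?_⟩
  have hx : t (Quotient.mk t x).out x := Quotient.mk_out (s := t) x
  rw [ncard_classesOn_split_ball, ← ball_eq hx, hg, hσ _ _ hx]

/-- One step of the construction of homogeneous chains: the classes of `p` in the classes of `t` are
grouped, and numbers of subclasses are assigned to them, so that the groups have equal sums. -/
theorem exists_split_sum {e p t : Setoid X} (hep : e ≤ p) (hpt : p ≤ t)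
    (hfin : ∀ x, (e.classesOn (t.ball x)).Finite) {a b q : ℕ} (hb : 0 < b) (hab : b < a)
    (hp : ∀ x, 3 * a ^ 2 ≤ (e.classesOn (p.ball x)).ncard ∧ (e.classesOn (p.ball x)).ncard ≤ q)
    (σ : X → ℕ) (hσ : ∀ x y, t x y → σ x = σ y)
    (h1 : ∀ x, ((a + 2 * b) * (2 * q + 1) + q) * σ x ≤ (e.classesOn (t.ball x)).ncard)
    (h2 : ∀ x, (e.classesOn (t.ball x)).ncard ≤ ((2 * a + b) * (2 * q + 1) - q) * σ x) :
    ∃ (r : Setoid X) (τ : X → ℕ), p ≤ r ∧ r ≤ t ∧ (∀ x y, p x y → τ x = τ y) ∧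
      (∀ x, b * τ x ≤ (e.classesOn (p.ball x)).ncard ∧
        (e.classesOn (p.ball x)).ncard ≤ a * τ x) ∧
      (∀ x, (r.classesOn (t.ball x)).ncard = σ x) ∧
      ∀ s, e ≤ s → s ≤ p → (∀ x, (s.classesOn (p.ball x)).ncard = τ x) →
        ∀ x, (s.classesOn (r.ball x)).ncard = 3 * (2 * q + 1) := by
  classical
  have hfp : ∀ x, (p.classesOn (t.ball x)).Finite := fun x => finite_classesOn_of_le hep (hfin x)
  let w : Quotient p → ℕ := fun c => (e.classesOn (p.ball c.out)).ncard
  have hw : ∀ x, (e.classesOn (p.ball x)).ncard = w (Quotient.mk p x) := fun x => by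
    simp only [w]
    rw [ball_eq (Quotient.mk_out (s := p) x)]
  have hsum : ∀ x, (e.classesOn (t.ball x)).ncard = ∑ c ∈ (hfp x).toFinset, w c := fun x =>
    ncard_classesOn_eq_sum hep (fun y hy z hz => t.trans hy (hpt hz)) (hfin x)
      (hfp x).coe_toFinset fun y _ => hw y
  have hσpos : ∀ x, 0 < σ x := fun x => by
    have := ncard_classesOn_pos (t.mem_ball_self x) (hfin x)
    exact Nat.pos_of_mul_pos_left (this.trans_le (h2 x))
  choose g τ hg hτ hgτ using fun c : Quotient t =>
    exists_groups_multiplicities (hfp c.out).toFinset w hb hab (fun c _ => hp c.out)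
      (hsum c.out ▸ h1 c.out) (hsum c.out ▸ h2 c.out) (hσpos c.out)
  have hout : ∀ x, t (Quotient.mk t x).out x := fun x => Quotient.mk_out (s := t) x
  have hmem : ∀ x c, c ∈ (hfp (Quotient.mk t x).out).toFinset ↔ c ∈ p.classesOn (t.ball x) :=
    fun x c => by rw [Finite.mem_toFinset, ball_eq (hout x)]
  refine ⟨split p t g, fun x => τ (Quotient.mk t x) (Quotient.mk p x), le_split hpt, split_le,
    fun x y hxy => ?_, fun x => ?_, fun x => ?_, fun s hes hsp hs x => ?_⟩
  · simp only [Quotient.sound hxy, Quotient.sound (hpt hxy)]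
  · rw [hw]
    exact hτ _ _ ((hmem x _).2 (mk_mem_classesOn (t.mem_ball_self x)))
  · rw [ncard_classesOn_split_ball, ← hσ _ _ (hout x), ← Finset.card_range (σ _),
      ← ncard_coe_finset]
    congr 1
    ext j
    rw [Finset.mem_coe, Finset.mem_range]
    constructor
    · rintro ⟨c, hc, rfl⟩
      exact hg _ c ((hmem x c).2 hc)
    · intro hj
      obtain ⟨c, hc, -⟩ := Finset.exists_ne_zero_of_sum_ne_zero
        (show ∑ c ∈ (hfp (Quotient.mk t x).out).toFinset with g (Quotient.mk t x) c = j,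
          τ (Quotient.mk t x) c ≠ 0 by rw [hgτ _ j hj]; omega)
      obtain ⟨hcT, rfl⟩ := Finset.mem_filter.1 hc
      exact ⟨c, (hmem x c).1 hcT, rfl⟩
  · rw [← hgτ (Quotient.mk t x) (g (Quotient.mk t x) (Quotient.mk p x))
      (hg _ _ ((hmem x _).2 (mk_mem_classesOn (t.mem_ball_self x))))]
    refine ncard_classesOn_eq_sum (A := (split p t g).ball x) hsp
      (fun y hy z hz => (split p t g).trans hy (le_split hpt hz))
      (finite_classesOn_of_le hes ((hfin x).subset (image_mono fun y hy => split_le hy))) ?_ ?_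
    · rw [Finset.coe_filter, classesOn_split_ball]
      ext c
      exact and_congr_left fun _ => hmem x c
    · intro y hy
      rw [hs y, Quotient.sound (split_le hy)]

/-- The data that control the sizes of the classes in a chain with finite classes. -/
structure IsFiniteTower (e : Setoid X) (s : ℕ → Setoid X) (a b q : ℕ → ℕ) : Prop where
  le_zero : e ≤ s 0
  mono : Monotone s
  finite : ∀ n x, (e.classesOn ((s n).ball x)).Finite
  le_ncard : ∀ n x, 3 * a n ^ 2 ≤ (e.classesOn ((s n).ball x)).ncard
  ncard_le : ∀ n x, (e.classesOn ((s n).ball x)).ncard ≤ q n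
  a_zero : a 0 = 2
  b_zero : b 0 = 1
  lt : ∀ n, b n < a n
  a_succ : ∀ n, a (n + 1) = (2 * a n + b n) * (2 * q n + 1) - q n
  b_succ : ∀ n, b (n + 1) = (a n + 2 * b n) * (2 * q n + 1) + q n

namespace IsFiniteTower

variable {e : Setoid X} {s : ℕ → Setoid X} {a b q : ℕ → ℕ}

theorem b_pos (h : IsFiniteTower e s a b q) (n : ℕ) : 0 < b n := by
  induction n with
  | zero => rw [h.b_zero]; exact one_pos
  | succ n ih =>
    rw [h.b_succ]
    positivity

theorem le (h : IsFiniteTower e s a b q) (n : ℕ) : e ≤ s n := h.le_zero.trans (h.mono n.zero_le)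

/-- Recursion from the top: `σ` prescribes the number of pieces in each class of the top level, and
`exists_split_sum` groups the classes one level below into these pieces while prescribing numbers
`τ` there, again within the admissible ratios. Homogeneity of a level follows once the lower level
meets its prescription. At level zero the ratios `1` and `2` only serve to ensure that `σ` is
positive and at most the size of the class. -/
theorem exists_chain_of_multiplicity (h : IsFiniteTower e s a b q) (n : ℕ) (σ : X → ℕ)
    (hσ : ∀ x y, s n x y → σ x = σ y)
    (hσN : ∀ x, b n * σ x ≤ (e.classesOn ((s n).ball x)).ncard ∧
      (e.classesOn ((s n).ball x)).ncard ≤ a n * σ x) :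
    ∃ ξ : ℕ → Setoid X, (∀ k ≤ n, e ≤ ξ k ∧ ξ k ≤ s k) ∧ (∀ k < n, s k ≤ ξ (k + 1)) ∧
      (∀ k < n, ∀ x, ((ξ k).classesOn ((ξ (k + 1)).ball x)).ncard = 3 * (2 * q k + 1)) ∧
      ∀ x, ((ξ n).classesOn ((s n).ball x)).ncard = σ x := by
  induction n generalizing σ with
  | zero =>
    simp only [h.a_zero, h.b_zero, one_mul] at hσN
    obtain ⟨r, h1, h2, h3⟩ := exists_split_ncard h.le_zero (h.finite 0) σ hσ (fun x => by
      have := ncard_classesOn_pos ((s 0).mem_ball_self x) (h.finite 0 x)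
      have := (hσN x).2
      omega) fun x => (hσN x).1
    refine ⟨fun _ => r, fun k hk => ?_, by simp, by simp, h3⟩
    obtain rfl := Nat.le_zero.1 hk
    exact ⟨h1, h2⟩
  | succ n ih =>
    rw [h.a_succ, h.b_succ] at hσN
    obtain ⟨r, τ, h1, h2, h3, h4, h5, h6⟩ := exists_split_sum (h.le n) (h.mono n.le_succ)
      (h.finite (n + 1)) (h.b_pos n) (h.lt n) (fun x => ⟨h.le_ncard n x, h.ncard_le n x⟩) σ hσ
      (fun x => (hσN x).1) fun x => (hσN x).2
    obtain ⟨ξ, i1, i2, i3, i4⟩ := ih τ h3 h4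
    have hu : ∀ k ≤ n, Function.update ξ (n + 1) r k = ξ k := fun k hk =>
      Function.update_of_ne (by omega) _ _
    have hu' : Function.update ξ (n + 1) r (n + 1) = r := Function.update_self _ _ _
    refine ⟨Function.update ξ (n + 1) r, fun k hk => ?_, fun k hk => ?_, fun k hk => ?_, ?_⟩
    · rcases Nat.le_succ_iff.1 hk with hk | rfl
      · rw [hu k hk]
        exact i1 k hk
      · rw [hu']
        exact ⟨(h.le n).trans h1, h2⟩
    · rcases Nat.lt_succ_iff_lt_or_eq.1 hk with hk | rfl
      · rw [hu _ hk]
        exact i2 k hk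
      · rw [hu']
        exact h1
    · rcases Nat.lt_succ_iff_lt_or_eq.1 hk with hk | rfl
      · rw [hu _ hk, hu _ hk.le]
        exact i3 k hk
      · rw [hu', hu _ le_rfl]
        exact h6 _ (i1 k le_rfl).1 (i1 k le_rfl).2 i4
    · rw [hu']
      exact h5

theorem exists_chain_le (h : IsFiniteTower e s a b q) (n : ℕ) :
    ∃ ξ : ℕ → Setoid X, (∀ k ≤ n, e ≤ ξ k ∧ ξ k ≤ s k) ∧ (∀ k < n, s k ≤ ξ (k + 1)) ∧
      ∀ k < n, ∀ x, ((ξ k).classesOn ((ξ (k + 1)).ball x)).ncard = 3 * (2 * q k + 1) := by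
  obtain ⟨ξ, h1, h2, h3, -⟩ := h.exists_chain_of_multiplicity n
    -- The top level is unconstrained, so any admissible number of pieces will do; the quotient by
    -- `b n` is one since the classes are large compared with `a n`.
    (fun x => (e.classesOn ((s n).ball x)).ncard / b n)
    (fun x y hxy => by simp only [ball_eq hxy]) (fun x => ⟨Nat.mul_div_le _ _, by
      obtain ⟨l, u, hlu, -, h3, h4, h5⟩ :=
        exists_multiplicity_bounds (h.b_pos n) (h.lt n) (h.le_ncard n x)
      have h6 : u ≤ (e.classesOn ((s n).ball x)).ncard / b n := by
        rw [Nat.le_div_iff_mul_le (h.b_pos n), mul_comm]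
        exact h3
      have h7 := h.lt n
      refine le_trans ?_ (Nat.mul_le_mul_left (a n) h6)
      nlinarith⟩)
  exact ⟨ξ, h1, h2, h3⟩

/-- A limit along an ultrafilter of finite homogeneous chains. -/
theorem exists_homogeneous_chain (h : IsFiniteTower e s a b q) :
    ∃ ξ : ℕ → Setoid X, ∀ k, ξ k ≤ s k ∧ s k ≤ ξ (k + 1) ∧
      ∀ x, #((ξ k).classesOn ((ξ (k + 1)).ball x)) = (3 * (2 * q k + 1) : ℕ) := by
  choose ξ h1 h2 h3 using h.exists_chain_le
  let 𝓤 : Ultrafilter ℕ := Filter.hyperfilter ℕ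
  let ζ : ℕ → Setoid X := fun k =>
    { r := fun x y => ∀ᶠ n in (𝓤 : Filter ℕ), ξ n k x y
      iseqv := ⟨fun x => .of_forall fun n => (ξ n k).refl x,
        fun hxy => hxy.mono fun n hn => (ξ n k).symm hn,
        fun hxy hyz => (hxy.and hyz).mono fun n hn => (ξ n k).trans hn.1 hn.2⟩ }
  have hζ : ∀ k x y, ζ k x y ↔ ∀ᶠ n in (𝓤 : Filter ℕ), ξ n k x y := fun k x y => Iff.rfl
  have hev : ∀ k, ∀ᶠ n in (𝓤 : Filter ℕ), k < n := fun k =>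
    Nat.hyperfilter_le_atTop (Filter.eventually_gt_atTop k)
  have heζ : ∀ k, e ≤ ζ k := fun k x y hxy => (hev k).mono fun n hn => (h1 n k hn.le).1 hxy
  have hζs : ∀ k, ζ k ≤ s k := fun k x y hxy => by
    obtain ⟨n, hn, hxy⟩ := ((hev k).and hxy).exists
    exact (h1 n k hn.le).2 hxy
  -- A class of `s m` is finite modulo `e`, so finitely many pairs of representatives decide the
  -- relation there, and almost every finite chain agrees with the limit on the whole class.
  have hagree : ∀ k m x, ∀ᶠ n in (𝓤 : Filter ℕ), ∀ y ∈ (s m).ball x, ∀ z ∈ (s m).ball x,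
      ζ k y z ↔ ξ n k y z := by
    intro k m x
    have hR := (h.finite m x).image Quotient.out
    have : ∀ᶠ n in (𝓤 : Filter ℕ), ∀ y ∈ Quotient.out '' e.classesOn ((s m).ball x),
        ∀ z ∈ Quotient.out '' e.classesOn ((s m).ball x), ζ k y z ↔ ξ n k y z := by
      rw [Filter.eventually_all_finite hR]
      intro y _
      rw [Filter.eventually_all_finite hR]
      intro z _
      by_cases hyz : ζ k y z
      · exact ((hζ k y z).1 hyz).mono fun n hn => by simp [hyz, hn]
      · exact (Ultrafilter.eventually_not.2 hyz).mono fun n hn => by simp [hyz, hn]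
    filter_upwards [this, hev k] with n hn hkn y hy z hz
    have hr : ∀ y, e (Quotient.mk e y).out y := fun y => Quotient.mk_out (s := e) y
    have := hn _ ⟨_, mk_mem_classesOn hy, rfl⟩ _ ⟨_, mk_mem_classesOn hz, rfl⟩
    have hswap : ∀ r : Setoid X, e ≤ r →
        (r (Quotient.mk e y).out (Quotient.mk e z).out ↔ r y z) := fun r her =>
      ⟨fun h => r.trans (r.symm (her (hr y))) (r.trans h (her (hr z))),
        fun h => r.trans (her (hr y)) (r.trans h (r.symm (her (hr z))))⟩
    rwa [hswap _ (heζ k), hswap _ (h1 n k hkn.le).1] at this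
  refine ⟨ζ, fun k => ⟨hζs k, fun x y hxy => (hev k).mono fun n hn => h2 n k hn hxy, fun x => ?_⟩⟩
  obtain ⟨n, ⟨hkn, hn1⟩, hn2⟩ :=
    (((hev (k + 1)).and (hagree k (k + 1) x)).and (hagree (k + 1) (k + 1) x)).exists
  have hball : (ζ (k + 1)).ball x = (ξ n (k + 1)).ball x := by
    ext y
    constructor
    · intro hy
      exact (hn2 x ((s (k + 1)).mem_ball_self x) y (hζs _ hy)).1 hy
    · intro hy
      exact (hn2 x ((s (k + 1)).mem_ball_self x) y ((h1 n (k + 1) hkn.le).2 hy)).2 hy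
  have hsub : (ξ n (k + 1)).ball x ⊆ (s (k + 1)).ball x := fun y hy => (h1 n (k + 1) hkn.le).2 hy
  rw [hball, mk_classesOn_congr fun y hy z hz => hn1 y (hsub hy) z (hsub hz),
    ← h3 n k (by omega) x, cast_ncard]
  exact finite_classesOn_of_le (h1 n k (by omega)).1 ((h.finite (k + 1) x).subset (image_mono hsub))

end IsFiniteTower

end Setoid

/-! ### Finite and countable covering numbers. -/

theorem exists_nat_sequence {D : Type*} {R : ℕ → D → D → Prop} {P : D → Prop}
    {d₀ : D} (h₀ : P d₀) (h : ∀ n d, P d → ∃ d', P d' ∧ R n d d') :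
    ∃ f : ℕ → D, f 0 = d₀ ∧ ∀ n, P (f n) ∧ R n (f n) (f (n + 1)) := by
  choose! g hg hR using h
  let f : ℕ → D := fun n => Nat.rec d₀ g n
  have hP : ∀ n, P (f n) := fun n => by
    induction n with
    | zero => exact h₀
    | succ n ih => exact hg n _ ih
  exact ⟨f, rfl, fun n => ⟨hP n, hR n _ (hP n)⟩⟩

namespace Ballean

section

variable {X Y : Type u} {E : Ballean X} {F : Ballean Y}

/-- A cellular ballean of finite `covSharp` is bounded. -/
theorem IsCellular.top_mem_cells_of_covSharp_lt [Nonempty X] (hE : E.IsCellular)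
    (h : E.covSharp < ℵ₀) : ⊤ ∈ E.cells := by
  obtain ⟨e, he, hlt⟩ := hE.exists_lt_covSharp
  obtain ⟨m, hm⟩ := lt_aleph0.1 h
  have hbd : ∀ s ∈ E.cells, ∀ x, #(e.classesOn (s.ball x)) ≤ m := fun s hs x =>
    (le_ciSup (f := fun x => #(e.classesOn (s.ball x))) bddAbove_of_small x).trans
      (hm ▸ (hlt s hs).le)
  have hfin : ∀ s ∈ E.cells, ∀ x, (e.classesOn (s.ball x)).Finite := fun s hs x =>
    lt_aleph0_iff_set_finite.1 ((hbd s hs x).trans_lt natCast_lt_aleph0)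
  obtain ⟨x⟩ := ‹Nonempty X›
  have hbdd : BddAbove {n | ∃ s ∈ E.cells, (e.classesOn (s.ball x)).ncard = n} := by
    refine ⟨m, ?_⟩
    rintro _ ⟨s, hs, rfl⟩
    have := hbd s hs x
    rwa [← cast_ncard (hfin s hs x), Nat.cast_le] at this
  -- Once the ball of `x` has the maximal number of `e`-classes, no larger cell can add a class, so
  -- the ball of `t`, which also contains `e`, is everything.
  obtain ⟨s, hs, hmax⟩ := Nat.sSup_mem
    (s := {n | ∃ s ∈ E.cells, (e.classesOn (s.ball x)).ncard = n}) ⟨_, e, he, rfl⟩ hbdd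
  obtain ⟨t, ht, het, hst⟩ := hE.exists_cell_ge he hs
  refine cells_mono (fun y z _ => ?_) ht
  have key : ∀ y, t x y := by
    intro y
    obtain ⟨r, hr, hxy⟩ := hE.exists_cell_rel x y
    obtain ⟨r', hr', htr, hrr⟩ := hE.exists_cell_ge ht hr
    have hsub : e.classesOn (s.ball x) ⊆ e.classesOn (r'.ball x) :=
      image_mono fun z hz => htr (hst hz)
    have heq := eq_of_subset_of_ncard_le hsub
      (by rw [hmax]; exact le_csSup hbdd ⟨r', hr', rfl⟩) (hfin r' hr' x)
    have hy : Quotient.mk e y ∈ e.classesOn (r'.ball x) := mk_mem_classesOn (hrr hxy)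
    rw [← heq] at hy
    obtain ⟨z, hz, hzy⟩ := hy
    exact t.trans (hst hz) (het (Quotient.exact hzy))
  exact t.trans (t.symm (key y)) (key z)

/-- If both covering numbers are countably infinite, then the cofinality is countable. -/
theorem IsOrdinal.cof_le_aleph0 [Nonempty X] (hEo : E.IsOrdinal) (hEc : E.IsCellular)
    (h1 : E.covSharp = ℵ₀) (h2 : E.covFlat = ℵ₀) : E.cof ≤ ℵ₀ := by
  by_contra! hcon
  obtain ⟨e, he, hlt⟩ := hEc.exists_lt_covSharp
  choose c hc hec hle using fun n : ℕ =>
    hEc.exists_le_of_lt_covFlat (h2.symm ▸ natCast_lt_aleph0 (n := n)) he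
  -- Uncountable cofinality would bound cells with arbitrarily many `e`-classes by a single cell,
  -- whose count is finite by `covSharp = ℵ₀`.
  obtain ⟨s, hs, hub⟩ := hEo.exists_upper_bound hEc (ι := ULift ℕ) (by simpa using hcon)
    (fun n => c n.down) fun n => hc _
  obtain ⟨m, hm⟩ := lt_aleph0.1 (h1 ▸ hlt s hs)
  obtain ⟨x⟩ := ‹Nonempty X›
  have h3 : ((m + 1 : ℕ) : Cardinal.{u}) ≤ m := (hle (m + 1) x).trans <|
    (mk_classesOn_mono e fun y hy => hub ⟨m + 1⟩ hy).trans <|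
      (le_ciSup (f := fun x => #(e.classesOn (s.ball x))) bddAbove_of_small x).trans_eq hm
  rw [Nat.cast_le] at h3
  omega

theorem IsCellular.exists_cofinal_nat [Nonempty X] (hE : E.IsCellular) (h : E.cof ≤ ℵ₀) :
    ∃ c : ℕ → Setoid X, (∀ n, c n ∈ E.cells) ∧ ∀ s ∈ E.cells, ∃ n, s ≤ c n := by
  obtain ⟨c, hc, hcof⟩ := hE.exists_cofinal
  obtain ⟨ε, hε⟩ := E.radii_nonempty
  obtain ⟨s, hs, -⟩ := hE.exists_cell hε
  obtain ⟨i, -⟩ := hcof s hs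
  have : Countable E.cof.ord.ToType := by
    rwa [← mk_le_aleph0_iff, mk_ord_toType]
  have : Nonempty E.cof.ord.ToType := ⟨i⟩
  obtain ⟨f, hf⟩ := exists_surjective_nat E.cof.ord.ToType
  refine ⟨fun n => c (f n), fun n => hc _, fun s hs => ?_⟩
  obtain ⟨i, hi⟩ := hcof s hs
  obtain ⟨n, rfl⟩ := hf i
  exact ⟨n, hi⟩

/-- A ballean all of whose balls are uniformly finite modulo `e`, with arbitrarily large balls,
contains large cells of prescribed minimal size. -/
theorem IsCellular.exists_large_cell (hE : E.IsCellular) (h1 : E.covSharp = ℵ₀)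
    (h2 : E.covFlat = ℵ₀) {e : Setoid X} (he : e ∈ E.cells)
    (hlt : ∀ s ∈ E.cells, ⨆ x, #(e.classesOn (s.ball x)) < E.covSharp) {s c : Setoid X}
    (hs : s ∈ E.cells) (hc : c ∈ E.cells) (m : ℕ) :
    ∃ t ∈ E.cells, e ≤ t ∧ s ≤ t ∧ c ≤ t ∧ ∃ q, ∀ x, (e.classesOn (t.ball x)).Finite ∧
      m ≤ (e.classesOn (t.ball x)).ncard ∧ (e.classesOn (t.ball x)).ncard ≤ q := by
  obtain ⟨r, hr, her, hm⟩ := hE.exists_le_of_lt_covFlat (h2.symm ▸ natCast_lt_aleph0 (n := m)) he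
  obtain ⟨r', hr', h3, h4⟩ := hE.exists_cell_ge hr hs
  obtain ⟨t, ht, h5, h6⟩ := hE.exists_cell_ge hr' hc
  obtain ⟨q, hq⟩ := lt_aleph0.1 (h1 ▸ hlt t ht)
  have hle : ∀ x, #(e.classesOn (t.ball x)) ≤ q := fun x =>
    (le_ciSup (f := fun x => #(e.classesOn (t.ball x))) bddAbove_of_small x).trans_eq hq
  refine ⟨t, ht, her.trans (h3.trans h5), h4.trans h5, h6, q, fun x => ?_⟩
  have hfin : (e.classesOn (t.ball x)).Finite :=
    lt_aleph0_iff_set_finite.1 ((hle x).trans_lt natCast_lt_aleph0)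
  have h7 := hle x
  have h8 : (m : Cardinal) ≤ #(e.classesOn (t.ball x)) :=
    (hm x).trans (mk_classesOn_mono e fun y hy => h5 (h3 hy))
  rw [← cast_ncard hfin, Nat.cast_le] at h7 h8
  exact ⟨hfin, h8, h7⟩

/-- Chains with finite classes of the same controlled sizes in two balleans. -/
theorem exists_finite_towers [Nonempty X] [Nonempty Y] (hEc : E.IsCellular) (hFc : F.IsCellular)
    (hE : E.cof ≤ ℵ₀) (hF : F.cof ≤ ℵ₀) (hE1 : E.covSharp = ℵ₀) (hE2 : E.covFlat = ℵ₀)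
    (hF1 : F.covSharp = ℵ₀) (hF2 : F.covFlat = ℵ₀) :
    ∃ (e : Setoid X) (s : ℕ → Setoid X) (e' : Setoid Y) (s' : ℕ → Setoid Y) (a b q : ℕ → ℕ),
      IsFiniteTower e s a b q ∧ IsFiniteTower e' s' a b q ∧
      ((∀ n, s n ∈ E.cells) ∧ ∀ r ∈ E.cells, ∃ n, r ≤ s n) ∧
      ((∀ n, s' n ∈ F.cells) ∧ ∀ r ∈ F.cells, ∃ n, r ≤ s' n) := by
  obtain ⟨e, he, hlt⟩ := hEc.exists_lt_covSharp
  obtain ⟨e', he', hlt'⟩ := hFc.exists_lt_covSharp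
  obtain ⟨c, hc, hcc⟩ := hEc.exists_cofinal_nat hE
  obtain ⟨c', hc', hcc'⟩ := hFc.exists_cofinal_nat hF
  let G : Setoid X → Setoid Y → ℕ → ℕ → Prop := fun s s' a q =>
    (s ∈ E.cells ∧ e ≤ s ∧ ∀ x, (e.classesOn (s.ball x)).Finite ∧
      3 * a ^ 2 ≤ (e.classesOn (s.ball x)).ncard ∧ (e.classesOn (s.ball x)).ncard ≤ q) ∧
    (s' ∈ F.cells ∧ e' ≤ s' ∧ ∀ x, (e'.classesOn (s'.ball x)).Finite ∧
      3 * a ^ 2 ≤ (e'.classesOn (s'.ball x)).ncard ∧ (e'.classesOn (s'.ball x)).ncard ≤ q)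
  have hG : ∀ s ∈ E.cells, ∀ s' ∈ F.cells, ∀ n a, ∃ t t' q, G t t' a q ∧ s ≤ t ∧ s' ≤ t' ∧
      c n ≤ t ∧ c' n ≤ t' := by
    intro s hs s' hs' n a
    obtain ⟨t, ht, h1, h2, h3, q, h4⟩ :=
      hEc.exists_large_cell hE1 hE2 he hlt hs (hc n) (3 * a ^ 2)
    obtain ⟨t', ht', h1', h2', h3', q', h4'⟩ :=
      hFc.exists_large_cell hF1 hF2 he' hlt' hs' (hc' n) (3 * a ^ 2)
    -- A common bound for both sides makes the branching numbers `3 * (2 * q + 1)` agree.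
    exact ⟨t, t', max q q',
      ⟨⟨ht, h1, fun x => ⟨(h4 x).1, (h4 x).2.1, (h4 x).2.2.trans (le_max_left _ _)⟩⟩,
        ht', h1', fun x => ⟨(h4' x).1, (h4' x).2.1, (h4' x).2.2.trans (le_max_right _ _)⟩⟩,
      h2, h2', h3, h3'⟩
  obtain ⟨t₀, t₀', q₀, h₀, -⟩ := hG e he e' he' 0 2
  -- a state consists of the two equivalences and the numbers `a`, `b`, `q`
  obtain ⟨f, hf0, hf⟩ := exists_nat_sequence (D := (Setoid X × Setoid Y) × ℕ × ℕ × ℕ)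
    (P := fun d => G d.1.1 d.1.2 d.2.1 d.2.2.2 ∧ d.2.2.1 < d.2.1)
    (R := fun n d d' => (d.1.1 ≤ d'.1.1 ∧ c n ≤ d'.1.1) ∧ (d.1.2 ≤ d'.1.2 ∧ c' n ≤ d'.1.2) ∧
      d'.2.1 = (2 * d.2.1 + d.2.2.1) * (2 * d.2.2.2 + 1) - d.2.2.2 ∧
      d'.2.2.1 = (d.2.1 + 2 * d.2.2.1) * (2 * d.2.2.2 + 1) + d.2.2.2)
    (d₀ := ((t₀, t₀'), 2, 1, q₀)) ⟨h₀, by norm_num⟩ (by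
      rintro n ⟨⟨s, s'⟩, a, b, q⟩ ⟨hs, hab⟩
      obtain ⟨t, t', q', h1, h2, h3, h4, h5⟩ := hG s hs.1.1 s' hs.2.1 n
        ((2 * a + b) * (2 * q + 1) - q)
      refine ⟨((t, t'), _, (a + 2 * b) * (2 * q + 1) + q, q'), ⟨h1, ?_⟩, ⟨h2, h4⟩, ⟨h3, h5⟩,
        rfl, rfl⟩
      -- The new gap is `(a - b) * (2 * q + 1) - 2 * q`, which is positive: this is the reason for
      -- the factor `2 * q + 1`.
      obtain ⟨d, rfl⟩ : ∃ d, a = b + d + 1 := ⟨a - b - 1, by dsimp only at hab; omega⟩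
      refine lt_tsub_iff_right.2 ?_
      dsimp only
      nlinarith [Nat.zero_le (d * q)])
  refine ⟨e, fun n => (f n).1.1, e', fun n => (f n).1.2, fun n => (f n).2.1, fun n => (f n).2.2.1,
    fun n => (f n).2.2.2, ?_, ?_, ⟨fun n => (hf n).1.1.1.1, fun r hr => ?_⟩,
    ⟨fun n => (hf n).1.1.2.1, fun r hr => ?_⟩⟩
  · exact
      { le_zero := (hf 0).1.1.1.2.1
        mono := monotone_nat_of_le_succ fun n => (hf n).2.1.1
        finite := fun n x => ((hf n).1.1.1.2.2 x).1
        le_ncard := fun n x => ((hf n).1.1.1.2.2 x).2.1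
        ncard_le := fun n x => ((hf n).1.1.1.2.2 x).2.2
        a_zero := by rw [hf0]
        b_zero := by rw [hf0]
        lt := fun n => (hf n).1.2
        a_succ := fun n => (hf n).2.2.2.1
        b_succ := fun n => (hf n).2.2.2.2 }
  · exact
      { le_zero := (hf 0).1.1.2.2.1
        mono := monotone_nat_of_le_succ fun n => (hf n).2.2.1.1
        finite := fun n x => ((hf n).1.1.2.2.2 x).1
        le_ncard := fun n x => ((hf n).1.1.2.2.2 x).2.1
        ncard_le := fun n x => ((hf n).1.1.2.2.2 x).2.2
        a_zero := by rw [hf0]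
        b_zero := by rw [hf0]
        lt := fun n => (hf n).1.2
        a_succ := fun n => (hf n).2.2.2.1
        b_succ := fun n => (hf n).2.2.2.2 }
  · obtain ⟨n, hn⟩ := hcc r hr
    exact ⟨n + 1, hn.trans (hf n).2.1.2⟩
  · obtain ⟨n, hn⟩ := hcc' r hr
    exact ⟨n + 1, hn.trans (hf n).2.2.1.2⟩

theorem coarselyEquivalent_of_eq_aleph0 [Nonempty X] [Nonempty Y] (hEc : E.IsCellular)
    (hEo : E.IsOrdinal) (hFc : F.IsCellular) (hFo : F.IsOrdinal)
    (hE1 : E.covSharp = ℵ₀) (hE2 : E.covFlat = ℵ₀)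
    (hF1 : F.covSharp = ℵ₀) (hF2 : F.covFlat = ℵ₀) : CoarselyEquivalent E F := by
  obtain ⟨e, s, e', s', a, b, q, h, h', ⟨hsE, hsc⟩, hsF, hsc'⟩ :=
    exists_finite_towers hEc hFc (hEo.cof_le_aleph0 hEc hE1 hE2) (hFo.cof_le_aleph0 hFc hF1 hF2)
      hE1 hE2 hF1 hF2
  obtain ⟨ξ, hξ⟩ := h.exists_homogeneous_chain
  obtain ⟨ζ, hζ⟩ := h'.exists_homogeneous_chain
  have hmξ : Monotone ξ := monotone_nat_of_le_succ fun k => (hξ k).1.trans (hξ k).2.1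
  have hmζ : Monotone ζ := monotone_nat_of_le_succ fun k => (hζ k).1.trans (hζ k).2.1
  have hbelow : ∀ {Z : Type u} {η : ℕ → Setoid Z} (hη : Monotone η) k,
      below η hη (k + 1) = η k := fun hη k =>
    le_antisymm (below_le k.succ_ne_zero fun j hj => hη (Nat.lt_succ_iff.1 hj))
      (le_below k.lt_succ_self)
  refine coarselyEquivalent_of_chain hEc hFc hmξ hmζ (fun k => cells_mono (hξ k).1 (hsE k))
    (fun k => cells_mono (hζ k).1 (hsF k)) (fun r hr => ?_) (fun r hr => ?_) fun k x y => ?_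
  · obtain ⟨n, hn⟩ := hsc r hr
    exact ⟨n + 1, hn.trans (hξ n).2.1⟩
  · obtain ⟨n, hn⟩ := hsc' r hr
    exact ⟨n + 1, hn.trans (hζ n).2.1⟩
  · rcases k with _ | k
    · change #((below ξ hmξ ⊥).classesOn ((ξ ⊥).ball x)) =
        #((below ζ hmζ ⊥).classesOn ((ζ ⊥).ball y))
      rw [below_bot, below_bot, mk_classesOn_ball_self, mk_classesOn_ball_self]
    · rw [hbelow, hbelow, (hξ k).2.2, (hζ k).2.2]

/-! ### Bounded balleans, assembly of the cases, and empty balleans. -/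

theorem coarselyEquivalent_of_top_mem_cells [Nonempty X] [Nonempty Y] (hE : ⊤ ∈ E.cells)
    (hF : ⊤ ∈ F.cells) : CoarselyEquivalent E F := by
  have h1 := exists_radius_eq_univ_of_top_mem_cells hE
  have h2 := exists_radius_eq_univ_of_top_mem_cells hF
  exact ⟨Set.univ, fun _ => ⟨Classical.arbitrary Y, trivial⟩,
    fun _ => ⟨Classical.arbitrary X, trivial⟩, fun _ _ => ⟨_, h2, fun _ _ _ _ _ _ _ => trivial⟩,
    fun _ _ => ⟨_, h1, fun _ _ _ _ _ _ _ => trivial⟩⟩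

theorem coarselyEquivalent_of_covering_numbers_eq [Nonempty X] [Nonempty Y] (hEc : E.IsCellular)
    (hEo : E.IsOrdinal) (hFc : F.IsCellular) (hFo : F.IsOrdinal) (hcof : E.cof = F.cof)
    (h1 : E.covFlat = E.covSharp) (h2 : E.covSharp = F.covSharp) (h3 : F.covSharp = F.covFlat) :
    CoarselyEquivalent E F := by
  rcases lt_trichotomy E.covSharp ℵ₀ with h | h | h
  · exact coarselyEquivalent_of_top_mem_cells (hEc.top_mem_cells_of_covSharp_lt h)
      (hFc.top_mem_cells_of_covSharp_lt (h2 ▸ h))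
  · exact coarselyEquivalent_of_eq_aleph0 hEc hEo hFc hFo h (h1.trans h) (h2.symm.trans h)
      (h3.symm.trans (h2.symm.trans h))
  · exact coarselyEquivalent_of_aleph0_lt hEc hEo hFc hFo hcof h rfl h1 h2.symm
      (h3.symm.trans h2.symm)

/-- Even a ball of `e` itself contains one `e`-class. The strict inequality separates nonempty
balleans from empty ones, whose `covSharp` is at most `1`. -/
theorem one_lt_covSharp [Nonempty X] (hE : E.IsCellular) : 1 < E.covSharp := by
  obtain ⟨e, he, hlt⟩ := hE.exists_lt_covSharp
  obtain ⟨x⟩ := ‹Nonempty X›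
  exact (mk_classesOn_pos e (e.mem_ball_self x)).trans_lt
    ((le_ciSup (f := fun x => #(e.classesOn (e.ball x))) bddAbove_of_small x).trans_lt (hlt e he))

theorem radii_nonempty_of_cof_ne_zero (h : E.cof ≠ 0) : E.radii.Nonempty := by
  obtain ⟨𝓑, hB, hcard⟩ := E.exists_isBase_mk_eq_cof
  rw [← hcard, Cardinal.mk_ne_zero_iff] at h
  obtain ⟨⟨ε, hε⟩⟩ := h
  obtain ⟨-, δ, hδ, -⟩ := hB.1 hε
  exact ⟨δ, hδ⟩

theorem cof_ne_zero_of_radii_nonempty (h : E.radii.Nonempty) : E.cof ≠ 0 := by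
  obtain ⟨𝓑, hB, hcard⟩ := E.exists_isBase_mk_eq_cof
  obtain ⟨ε, hε⟩ := h
  obtain ⟨δ, hδ, -⟩ := hB.2 ε ⟨E.isEntourage ε hε, ε, hε, subset_rfl⟩
  rw [← hcard, Cardinal.mk_ne_zero_iff]
  exact ⟨⟨δ, hδ⟩⟩

/-- Matters only on empty sets: a coarse multi-map needs a target radius for each source radius even
when there is nothing to contain. -/
theorem radii_nonempty_iff_of_cof_eq (h : E.cof = F.cof) :
    E.radii.Nonempty ↔ F.radii.Nonempty :=
  ⟨fun hE => radii_nonempty_of_cof_ne_zero (h ▸ cof_ne_zero_of_radii_nonempty hE),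
    fun hF => radii_nonempty_of_cof_ne_zero (h ▸ cof_ne_zero_of_radii_nonempty hF)⟩

theorem coarselyEquivalent_of_isEmpty [IsEmpty X] [IsEmpty Y]
    (h : E.radii.Nonempty ↔ F.radii.Nonempty) : CoarselyEquivalent E F := by
  refine ⟨∅, fun x => isEmptyElim x, fun y => isEmptyElim y, fun ε hε => ?_, fun δ hδ => ?_⟩
  · obtain ⟨δ, hδ⟩ := h.1 ⟨ε, hε⟩
    exact ⟨δ, hδ, fun x => isEmptyElim x⟩
  · obtain ⟨ε, hε⟩ := h.2 ⟨δ, hδ⟩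
    exact ⟨ε, hε, fun y => isEmptyElim y⟩

theorem covSharp_le_one_of_isEmpty [IsEmpty X] : E.covSharp ≤ 1 := by
  rcases E.radii.eq_empty_or_nonempty with h | ⟨ε, hε⟩
  · simp [covSharp, h]
  · exact csInf_le' ⟨ε, hε, fun δ _ => by simp⟩

theorem covFlat_le_one_of_isEmpty [IsEmpty X] (h : E.radii.Nonempty) : E.covFlat ≤ 1 := by
  refine csSup_le' fun κ hκ => ?_
  by_contra! hlt
  obtain ⟨ε, hε⟩ := h
  obtain ⟨δ, -, hle⟩ := hκ 1 hlt ε hε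
  simp [iInf, Set.range_eq_empty] at hle

end

end Ballean

theorem mainTheorem1 {X Y : Type u} (E : Ballean X) (F : Ballean Y)
    (hEc : E.IsCellular) (hEo : E.IsOrdinal) (hFc : F.IsCellular) (hFo : F.IsOrdinal)
    (hcof : E.cof = F.cof) :
    (E.covSharp ≤ F.covFlat → ∃ A : Set Y, Ballean.CoarselyEquivalent E (F.sub A)) ∧
    (E.covFlat = E.covSharp ∧ E.covSharp = F.covSharp ∧ F.covSharp = F.covFlat →
      Ballean.CoarselyEquivalent E F) := by
  have hr := Ballean.radii_nonempty_iff_of_cof_eq hcof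
  rcases isEmpty_or_nonempty X with hX | hX
  · refine ⟨fun _ => ⟨∅, Ballean.coarselyEquivalent_of_isEmpty (hr.trans ?_)⟩, fun h => ?_⟩
    · exact Set.image_nonempty.symm
    · rcases isEmpty_or_nonempty Y with hY | hY
      · exact Ballean.coarselyEquivalent_of_isEmpty hr
      · exact absurd (h.2.1.symm.trans_le Ballean.covSharp_le_one_of_isEmpty)
          (Ballean.one_lt_covSharp hFc).not_ge
  · rcases isEmpty_or_nonempty Y with hY | hY
    · refine ⟨fun h => ?_, fun h => ?_⟩
      · exact absurd (h.trans (Ballean.covFlat_le_one_of_isEmpty (hr.1 E.radii_nonempty)))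
          (Ballean.one_lt_covSharp hEc).not_ge
      · exact absurd (h.2.1.trans_le Ballean.covSharp_le_one_of_isEmpty)
          (Ballean.one_lt_covSharp hEc).not_ge
    · exact ⟨Ballean.exists_coarselyEquivalent_sub hEc hEo hFc hFo hcof, fun h =>
        Ballean.coarselyEquivalent_of_covering_numbers_eq hEc hEo hFc hFo hcof h.1 h.2.1 h.2.2⟩
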